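/- Consider an $m$-DOF rigid robot manipulator $M(q)\ddot q+C(q,\dot q)\dot q+G(q)+\tau_d(\dot q,t)=u_a$ with $M$ continuous and $M(q)$ symmetric positive definite, whose actuators are subject to faults $u_a=\rho(t)u+\varepsilon(t)$, where $\rho(t)=\mathrm{diag}\{\rho_1(t),\dots,\rho_m(t)\}$ with $\rho_j(t)\in(0,1]$ (possibly discontinuous in $t$) and $\|\varepsilon(t)\|<\bar\varepsilon$. With $g=M^{-1}$, $F=g(-C\dot q-G-\tau_d+\varepsilon)$, it reads in normal form $\ddot q=F(q,\dot q,t)+g(q)\rho(t)u$. Let $q_d$ be a desired trajectory which is bounded together with $\dot q_d$ and $\ddot q_d$ on $[0,\infty)$; put $e=q-q_d$ and $s=\lambda_1 e+\dot e$ with $\lambda_1>0$. Assume that there is a differentiable symmetric positive definite matrix function $\alpha(q,t)$, $t\ge 0$, such that (i) $\alpha g\rho+\rho g^T\alpha$ is uniformly positive or uniformly negative definite: there are constants $\underline\lambda,\bar\lambda$ with $\underline\lambda\bar\lambda>0$ such that all its eigenvalues lie in $[\underline\lambda,\bar\lambda]$ for all $q\in\mathbb R^m$, $t\ge0$; (ii)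 there are positive constants $a_f^*,a_1,a_2$ and nonnegative continuous functions $\varphi_f^*(q,\dot q)$, $\varphi_1(q)$, $\varphi_2(q,\dot q)$ such that for all $q,\dot q\in\mathbb R^m$, $t\ge0$: $\|F(q,\dot q,t)\|\le a_f^*\varphi_f^*(q,\dot q)$, $\|\alpha(q,t)\|\le a_1\varphi_1(q)$, and the time derivative of $\alpha$ along motions satisfies $\big\|\frac{\partial\alpha}{\partial t}+\frac{\partial \alpha}{\partial q}\dot q\big\|\le a_2\varphi_2(q,\dot q)$. Let $k,\sigma_1,\sigma_2>0$, let $\nu\ge 0$ be integrable on $[0,\infty)$, and let $\hbar:[0,\infty)\to\mathbb R$ be a BL-type Nussbaum function of level $L\in(1,\infty]$: $\hbar$ is $C^1$ and, with $A(\zeta)=\int_0^\zeta\max\{0,\hbar\}$, $B(\zeta)=\int_0^\zeta\max\{0,-\hbar\}$, one has $A(\zeta)/\zeta\to\infty$, $B(\zeta)/\zeta\to\infty$, $\limsup A/B\ge L$ and $\limsup B/A\ge L$ as $\zeta\to\infty$; assume $L>\max\{\underline\lambda/\bar\lambda,\bar\lambda/\underline\lambda\}$ (no restriction if $L=\infty$).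 Apply the controller $$u=\hbar(\zeta)\eta,\quad \eta=ks+\frac{\hat\theta\varphi^2 s}{\varphi\|s\|+\nu},\quad \dot\zeta=\sigma_1s^T\eta,\quad \dot{\hat\theta}=\frac{\sigma_2\varphi^2\|s\|^2}{\varphi\|s\|+\nu},\quad \hat\theta(0)\ge0,\ \zeta(0)\ge 0,$$ with $\varphi=\varphi_1(\|\lambda_1\dot e\|+\varphi_f^*+1)+\tfrac12\varphi_2\|s\|$ (a quotient $0/0$ is read as $0$). Solutions are meant in the sense of Carathéodory. Then: 1) All closed-loop signals are globally uniformly bounded: for every $R$ there is $B$ such that, along every solution on an interval $[0,T)$, $0<T\le\infty$, with $\|q(0)\|,\|\dot q(0)\|,\zeta(0),\hat\theta(0)\le R$, the signals $q,\dot q,e,\dot e,s,\zeta,\hat\theta,\varphi,\eta,u,u_a$ and the right-hand sides of the equations for $\ddot q,\dot\zeta,\dot{\hat\theta}$ are bounded by $B$ on $[0,T)$. 2) Along every solution on $[0,\infty)$, $e(t)\to0$ and $\dot e(t)\to 0$ as $t\to\infty$. -/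

import Mathlib

open MeasureTheory Filter Set Topology
open scoped Matrix.Norms.L2Operator

namespace RobotFTC

noncomputable section

/-- Vectors of `ℝᵐ` with the Euclidean norm. -/
abbrev Vec (m : ℕ) := EuclideanSpace ℝ (Fin m)

/-- Real `m × m` matrices, normed by the operator norm induced by the Euclidean norm. -/
abbrev Mat (m : ℕ) := Matrix (Fin m) (Fin m) ℝ

/-- Matrix-vector product on `ℝᵐ`. -/
def mulV {m : ℕ} (A : Mat m) (x : Vec m) : Vec m :=
  WithLp.toLp 2 (A.mulVec x.ofLp)

/-! ### BL-type Nussbaum functions -/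

/-- `∫₀^z h⁺`. -/
def posInt (h : ℝ → ℝ) (z : ℝ) : ℝ := ∫ τ in (0 : ℝ)..z, max 0 (h τ)

/-- `∫₀^z h⁻`. -/
def negInt (h : ℝ → ℝ) (z : ℝ) : ℝ := ∫ τ in (0 : ℝ)..z, max 0 (-h τ)

/-- A BL-type Nussbaum function on `[0,∞)` of level `L ∈ (1,∞]`. The upper limits are taken
in the extended reals; `L = ⊤` is the B-type case, in which the inequalities for the upper limits
hold for every finite level. -/
structure IsBLNussbaum (h : ℝ → ℝ) (L : EReal) : Prop where
  one_lt : 1 < L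
  contDiffOn : ContDiffOn ℝ 1 h (Ici 0)
  pos_tendsto : Tendsto (fun z => posInt h z / z) atTop atTop
  neg_tendsto : Tendsto (fun z => negInt h z / z) atTop atTop
  pos_limsup : L ≤ limsup (fun z => ((posInt h z / negInt h z : ℝ) : EReal)) atTop
  neg_limsup : L ≤ limsup (fun z => ((negInt h z / posInt h z : ℝ) : EReal)) atTop

/-! ### The manipulator, the actuator faults and the desired trajectory -/

/-- The coefficients of an `m`-DOF rigid manipulator
`M(q) q̈ + C(q,q̇) q̇ + G(q) + τ_d(q̇,t) = u_a`. -/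
structure Robot (m : ℕ) where
  /-- inertia matrix -/
  M : Vec m → Mat m
  /-- centripetal-Coriolis matrix -/
  C : Vec m → Vec m → Mat m
  /-- gravitational force -/
  G : Vec m → Vec m
  /-- external disturbance -/
  tau : Vec m → ℝ → Vec m
  M_continuous : Continuous M
  /-- symmetric and positive definite -/
  M_posDef : ∀ q, (M q).PosDef

/-- Partial-loss-of-effectiveness actuator faults `u_a = ρ(t) u + ε(t)` with
`ρ = diag (ρ₁, …, ρₘ)`. No continuity in time is required. -/
structure Fault (m : ℕ) where
  /-- diagonal of the effectiveness matrix -/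
  rho : ℝ → Fin m → ℝ
  /-- uncontrollable portion of the actuator output -/
  eps : ℝ → Vec m
  rho_mem : ∀ t, 0 ≤ t → ∀ j, rho t j ∈ Ioc (0 : ℝ) 1
  eps_bounded : ∃ b : ℝ, ∀ t, 0 ≤ t → ‖eps t‖ < b

/-- The matrix `ρ(t)`. -/
def Fault.mat {m : ℕ} (flt : Fault m) (t : ℝ) : Mat m := Matrix.diagonal (flt.rho t)

/-- A desired joint trajectory which is bounded together with its first two derivatives. -/
structure Reference (m : ℕ) where
  qd : ℝ → Vec m
  /-- first derivative -/
  vd : ℝ → Vec m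
  /-- second derivative -/
  ad : ℝ → Vec m
  qd_deriv : ∀ t, 0 ≤ t → HasDerivWithinAt qd (vd t) (Ici 0) t
  vd_deriv : ∀ t, 0 ≤ t → HasDerivWithinAt vd (ad t) (Ici 0) t
  qd_bounded : ∃ b : ℝ, ∀ t, 0 ≤ t → ‖qd t‖ ≤ b
  vd_bounded : ∃ b : ℝ, ∀ t, 0 ≤ t → ‖vd t‖ ≤ b
  ad_bounded : ∃ b : ℝ, ∀ t, 0 ≤ t → ‖ad t‖ ≤ b

/-- Input gain `g = M⁻¹` of the normal form. -/
def Robot.gain {m : ℕ} (rob : Robot m) (q : Vec m) : Mat m := (rob.M q)⁻¹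

/-- The lumped term `f + d + g ε = g (-C q̇ - G - τ_d + ε)` of the normal form. -/
def lumped {m : ℕ} (rob : Robot m) (flt : Fault m) (q v : Vec m) (t : ℝ) : Vec m :=
  mulV (rob.gain q) (-mulV (rob.C q v) v - rob.G q - rob.tau v t + flt.eps t)

/-! ### The controller -/

/-- The known bounding functions `φ₁(q)`, `φ₂(q,q̇)`, `φ_f^*(q,q̇)`. -/
structure BoundFns (m : ℕ) where
  phi1 : Vec m → ℝ
  phi2 : Vec m → Vec m → ℝ
  phif : Vec m → Vec m → ℝ
  phi1_nonneg : ∀ q, 0 ≤ phi1 q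
  phi2_nonneg : ∀ q v, 0 ≤ phi2 q v
  phif_nonneg : ∀ q v, 0 ≤ phif q v
  phi1_continuous : Continuous phi1
  phi2_continuous : Continuous fun p : Vec m × Vec m => phi2 p.1 p.2
  phif_continuous : Continuous fun p : Vec m × Vec m => phif p.1 p.2

/-- Design parameters `λ₁, k, σ₁, σ₂ > 0` and a nonnegative integrable function `ν`
on `[0,∞)`. (`z + λ₁` is Hurwitz exactly when `λ₁ > 0`.) -/
structure Design where
  lam1 : ℝ
  k : ℝ
  sigma1 : ℝ
  sigma2 : ℝ
  nu : ℝ → ℝ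
  lam1_pos : 0 < lam1
  k_pos : 0 < k
  sigma1_pos : 0 < sigma1
  sigma2_pos : 0 < sigma2
  nu_nonneg : ∀ t, 0 ≤ t → 0 ≤ nu t
  nu_integrable : IntegrableOn nu (Ici 0)

section Signals

variable {m : ℕ} (rob : Robot m) (flt : Fault m) (ref : Reference m) (bf : BoundFns m)
  (des : Design) (h : ℝ → ℝ)

/-- Tracking error `e = q - q_d`. -/
def err (t : ℝ) (q : Vec m) : Vec m := q - ref.qd t

/-- `ė = q̇ - q̇_d`. -/
def errDot (t : ℝ) (v : Vec m) : Vec m := v - ref.vd t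

/-- Filtered error `s = λ₁ e + ė`. -/
def filt (t : ℝ) (q v : Vec m) : Vec m := des.lam1 • err ref t q + errDot ref t v

/-- Core function `φ = φ₁ (‖Φ‖ + φ_f^* + 1) + ½ φ₂ ‖s‖` with `Φ = λ₁ ė`. -/
def core (t : ℝ) (q v : Vec m) : ℝ :=
  bf.phi1 q * (‖des.lam1 • errDot ref t v‖ + bf.phif q v + 1)
    + 1 / 2 * bf.phi2 q v * ‖filt ref des t q v‖

/-- `η = k s + θ̂ φ² s / (φ ‖s‖ + ν)`. Whenever the denominator vanishes, so does the numerator, and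
the quotient is read as `0`. -/
def eta (t : ℝ) (q v : Vec m) (th : ℝ) : Vec m :=
  des.k • filt ref des t q v
    + (th * core ref bf des t q v ^ 2
        / (core ref bf des t q v * ‖filt ref des t q v‖ + des.nu t)) • filt ref des t q v

/-- Designed control `u = h(ζ) η`. -/
def ctrl (t : ℝ) (q v : Vec m) (z th : ℝ) : Vec m := h z • eta ref bf des t q v th

/-- Actual actuator output `u_a = ρ u + ε`. -/
def actual (t : ℝ) (q v : Vec m) (z th : ℝ) : Vec m :=
  mulV (flt.mat t) (ctrl ref bf des h t q v z th) + flt.eps t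

/-- Right-hand side of `q̈ = f + d + g ε + g ρ u`. -/
def accRHS (t : ℝ) (q v : Vec m) (z th : ℝ) : Vec m :=
  lumped rob flt q v t + mulV (rob.gain q * flt.mat t) (ctrl ref bf des h t q v z th)

/-- Right-hand side of `ζ̇ = σ₁ sᵀ η`. -/
def zetaRHS (t : ℝ) (q v : Vec m) (th : ℝ) : ℝ :=
  des.sigma1 * inner ℝ (filt ref des t q v) (eta ref bf des t q v th)

/-- Right-hand side of the adaptive law for `θ̂`. -/
def thetaRHS (t : ℝ) (q v : Vec m) : ℝ :=
  des.sigma2 * core ref bf des t q v ^ 2 * ‖filt ref des t q v‖ ^ 2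
    / (core ref bf des t q v * ‖filt ref des t q v‖ + des.nu t)

end Signals

/-- `y` is a Carathéodory solution of `ẏ = F(t)` on `[0,T)`, that is, `y` is locally absolutely
continuous there and the equation holds at almost every time (integral form). -/
def IsPrimitiveOn {E : Type*} [NormedAddCommGroup E] [NormedSpace ℝ E]
    (T : EReal) (y F : ℝ → E) : Prop :=
  ∀ t : ℝ, 0 ≤ t → (t : EReal) < T →
    IntervalIntegrable F volume 0 t ∧ y t = y 0 + ∫ τ in (0 : ℝ)..t, F τ

/-- `(q, q̇, ζ, θ̂) = (q, v, z, th)` is a solution on `[0,T)`, `T ∈ (0,∞]`, of the closed loop made of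
the faulty manipulator, the control law and the adaptive laws. -/
structure IsClosedLoop {m : ℕ} (rob : Robot m) (flt : Fault m) (ref : Reference m)
    (bf : BoundFns m) (des : Design) (h : ℝ → ℝ) (T : EReal)
    (q v : ℝ → Vec m) (z th : ℝ → ℝ) : Prop where
  zeta_init : 0 ≤ z 0
  theta_init : 0 ≤ th 0
  pos_eq : IsPrimitiveOn T q v
  vel_eq : IsPrimitiveOn T v fun t => accRHS rob flt ref bf des h t (q t) (v t) (z t) (th t)
  zeta_eq : IsPrimitiveOn T z fun t => zetaRHS ref bf des t (q t) (v t) (th t)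
  theta_eq : IsPrimitiveOn T th fun t => thetaRHS ref bf des t (q t) (v t)

/-! ### Standing conditions on the auxiliary matrix and on the lumped term -/

/-- The space-time domain `ℝᵐ × [0,∞)`. -/
def dom (m : ℕ) : Set (Vec m × ℝ) := univ ×ˢ Ici 0

/-- Controllability under faults: `α(q,t)` is a differentiable, symmetric positive definite matrix
such that `α g ρ + ρ gᵀ α` is uniformly positive or uniformly negative definite: all its eigenvalues
lie in one compact interval `[lo, hi]` that does not contain `0`. -/
structure Controllability {m : ℕ} (rob : Robot m) (flt : Fault m) (α : Vec m → ℝ → Mat m)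
    (lo hi : ℝ) : Prop where
  differentiable : DifferentiableOn ℝ (fun p : Vec m × ℝ => α p.1 p.2) (dom m)
  posDef : ∀ q t, 0 ≤ t → (α q t).PosDef
  same_sign : 0 < lo * hi
  eig_mem : ∀ q t, 0 ≤ t → ∀ μ ∈ spectrum ℝ
    (α q t * rob.gain q * flt.mat t + flt.mat t * (rob.gain q).transpose * α q t), μ ∈ Icc lo hi

/-- Growth conditions: for some positive constants,
`‖f + g ε + d‖ ≤ a_f φ_f^*(q,q̇)`, `‖α(q,t)‖ ≤ a₁ φ₁(q)`, and the time derivative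
`∂α/∂t + (∂α/∂q) q̇` of `α` along the motion is at most `a₂ φ₂(q,q̇)` in norm. -/
def GrowthBounds {m : ℕ} (rob : Robot m) (flt : Fault m) (bf : BoundFns m)
    (α : Vec m → ℝ → Mat m) : Prop :=
  ∃ af a1 a2 : ℝ, 0 < af ∧ 0 < a1 ∧ 0 < a2 ∧ ∀ (q v : Vec m) (t : ℝ), 0 ≤ t →
    ‖lumped rob flt q v t‖ ≤ af * bf.phif q v ∧
    ‖α q t‖ ≤ a1 * bf.phi1 q ∧
    ‖fderivWithin ℝ (fun p : Vec m × ℝ => α p.1 p.2) (dom m) (q, t) (v, 1)‖ ≤ a2 * bf.phi2 q v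

/-- At time `t`, every signal of the closed loop is bounded by `B`. -/
def SignalsBoundedBy {m : ℕ} (rob : Robot m) (flt : Fault m) (ref : Reference m)
    (bf : BoundFns m) (des : Design) (h : ℝ → ℝ) (B t : ℝ) (q v : Vec m) (z th : ℝ) : Prop :=
  ‖q‖ ≤ B ∧ ‖v‖ ≤ B ∧ |z| ≤ B ∧ |th| ≤ B ∧
  ‖err ref t q‖ ≤ B ∧ ‖errDot ref t v‖ ≤ B ∧ ‖filt ref des t q v‖ ≤ B ∧
  |core ref bf des t q v| ≤ B ∧ ‖eta ref bf des t q v th‖ ≤ B ∧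
  ‖ctrl ref bf des h t q v z th‖ ≤ B ∧ ‖actual flt ref bf des h t q v z th‖ ≤ B ∧
  ‖accRHS rob flt ref bf des h t q v z th‖ ≤ B ∧
  |zetaRHS ref bf des t q v th| ≤ B ∧ |thetaRHS ref bf des t q v| ≤ B

end

end RobotFTC

open RobotFTC

/-!
# Boundedness and convergence of the fault-tolerant adaptive controller

The Lyapunov function is `V = ½ sᵀ α(q,t) s`. The control enters `V̇` only through
`h(ζ) sᵀ (α g ρ) s`, whose symmetric part lies between `lo` and `hi`; since `ζ̇` is a multiple of
`‖s‖²`, this term is at most `(hi h⁺(ζ) - lo h⁻(ζ)) ζ̇ / (2σ₁)`, the time derivative of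
`(hi ∫ h⁺ - lo ∫ h⁻) / (2σ₁)` evaluated at `ζ`. The other terms are at most `θ φ ‖s‖` for an unknown
constant `θ`, and `φ ‖s‖ ≤ ν + θ̂' / σ₂` by the update law. On the other hand
`θ̂² / (2σ₂) + k ∫ ‖s‖²` grows exactly like `ζ / σ₁`, so `θ θ̂ / σ₂` is at most an affine function of
`ζ`. Altogether `V` is bounded by an affine function of `ζ` plus the Nussbaum combination
(`IsClosedLoop.exists_lyapunov_le`, `IsClosedLoop.energy_le`). The latter beats every affine function
at some level beyond the initial value of `ζ` (`IsBLNussbaum.exists_nussInt_neg`); as `V ≥ 0` and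
`ζ` is continuous, `ζ` never reaches that level (`exists_zeta_le`).

Hence `ζ`, `θ̂`, `V` and `∫ ‖s‖²` are bounded. Because `α` need not be uniformly positive definite,
a bound on `V` does not bound `s` by itself. But `ė = -λ₁ e + s` with `s ∈ L²` bounds `e` and
`∫ ‖e‖²` (`IsClosedLoop.err_le`), so `q` stays in a compact set, where `g` is bounded. There the
uniform nondegeneracy of `α g ρ` and the Cauchy-Schwarz inequality for `α` give a lower bound for
`V` in terms of `‖s‖` (`Controllability.exists_norm_le`). All remaining signals are then bounded,
`e` and `s` are Lipschitz and square integrable, and Barbalat's lemma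
(`tendsto_zero_of_integral_sq_le`) yields convergence.

Solutions satisfy the equations only almost everywhere and `α` is only differentiable, so the
estimates are integrated within the class of absolutely continuous functions (`HasACDeriv`).
-/

namespace RobotFTC

/-! ### Absolutely continuous functions with a known derivative -/

theorem absolutelyContinuousOnInterval_of_dist_le {X Y : Type*} [PseudoMetricSpace X]
    [PseudoMetricSpace Y] {f : ℝ → X} {g : ℝ → Y} {a b : ℝ}
    (hg : AbsolutelyContinuousOnInterval g a b)
    (hfg : ∀ x ∈ uIcc a b, ∀ y ∈ uIcc a b, dist (f x) (f y) ≤ dist (g x) (g y)) :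
    AbsolutelyContinuousOnInterval f a b := by
  unfold AbsolutelyContinuousOnInterval at hg ⊢
  refine squeeze_zero' (Eventually.of_forall fun _ => Finset.sum_nonneg fun i _ => dist_nonneg)
    ?_ hg
  rw [eventually_inf_principal]
  filter_upwards with ⟨n, I⟩ hnI
  exact Finset.sum_le_sum fun i hi => hfg _ (hnI.1 i hi).1 _ (hnI.1 i hi).2

section AbsolutelyContinuous

variable {E F G : Type*} [NormedAddCommGroup E] [NormedSpace ℝ E]
  [NormedAddCommGroup F] [NormedSpace ℝ F] [NormedAddCommGroup G] [NormedSpace ℝ G]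

/-- `f` is absolutely continuous on `[0,b]` and has the derivative `f'` almost everywhere there.
Every Lyapunov-type estimate is carried out for pairs of this kind. -/
structure HasACDeriv (b : ℝ) (f f' : ℝ → E) : Prop where
  ac : AbsolutelyContinuousOnInterval f 0 b
  ae_deriv : ∀ᵐ t, t ∈ Ioo 0 b → HasDerivAt f (f' t) t

theorem AbsolutelyContinuousOnInterval.bilinear {f : ℝ → E} {g : ℝ → F} {a b : ℝ}
    (B : E →L[ℝ] F →L[ℝ] G)
    (hf : AbsolutelyContinuousOnInterval f a b) (hg : AbsolutelyContinuousOnInterval g a b) :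
    AbsolutelyContinuousOnInterval (fun t => B (f t) (g t)) a b := by
  obtain ⟨C, hC⟩ := hf.exists_bound
  obtain ⟨D, hD⟩ := hg.exists_bound
  unfold AbsolutelyContinuousOnInterval at hf hg ⊢
  refine squeeze_zero' (Eventually.of_forall fun _ => Finset.sum_nonneg fun i _ => dist_nonneg)
    ?_ (by simpa using (hg.const_mul (‖B‖ * C)).add (hf.const_mul (‖B‖ * D)))
  rw [eventually_inf_principal]
  filter_upwards with ⟨n, I⟩ hnI
  simp only [Finset.mul_sum, ← Finset.sum_add_distrib]
  refine Finset.sum_le_sum fun i hi => ?_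
  have h1 := (hnI.1 i hi).1
  have h2 := (hnI.1 i hi).2
  have e : B (f (I i).1) (g (I i).1) - B (f (I i).2) (g (I i).2)
      = B (f (I i).1) (g (I i).1 - g (I i).2) + B (f (I i).1 - f (I i).2) (g (I i).2) := by
    simp
  rw [dist_eq_norm, dist_eq_norm, dist_eq_norm, e]
  refine (norm_add_le _ _).trans (add_le_add ?_ ?_)
  · refine (B.le_opNorm₂ _ _).trans ?_
    gcongr
    exact hC _ h1
  · refine (B.le_opNorm₂ _ _).trans ?_
    rw [mul_right_comm]
    gcongr
    exact hD _ h2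

namespace HasACDeriv

variable {b : ℝ} {f f' g g' : ℝ → E}

theorem continuousOn (hf : HasACDeriv b f f') (hb : 0 ≤ b) : ContinuousOn f (Icc 0 b) := by
  simpa [uIcc_of_le hb] using hf.ac.continuousOn

theorem congr_deriv (hf : HasACDeriv b f f') (h : ∀ t ∈ Ioo 0 b, f' t = g' t) :
    HasACDeriv b f g' :=
  ⟨hf.ac, by filter_upwards [hf.ae_deriv] with t ht hm; rw [← h t hm]; exact ht hm⟩

theorem add (hf : HasACDeriv b f f') (hg : HasACDeriv b g g') :
    HasACDeriv b (fun t => f t + g t) (fun t => f' t + g' t) :=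
  ⟨hf.ac.add hg.ac, by
    filter_upwards [hf.ae_deriv, hg.ae_deriv] with t h1 h2 ht using (h1 ht).add (h2 ht)⟩

theorem sub (hf : HasACDeriv b f f') (hg : HasACDeriv b g g') :
    HasACDeriv b (fun t => f t - g t) (fun t => f' t - g' t) :=
  ⟨hf.ac.sub hg.ac, by
    filter_upwards [hf.ae_deriv, hg.ae_deriv] with t h1 h2 ht using (h1 ht).sub (h2 ht)⟩

theorem const_smul (c : ℝ) (hf : HasACDeriv b f f') :
    HasACDeriv b (fun t => c • f t) (fun t => c • f' t) :=
  ⟨hf.ac.const_smul c, by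
    filter_upwards [hf.ae_deriv] with t h1 ht using (h1 ht).const_smul c⟩

theorem const_mul {f f' : ℝ → ℝ} (c : ℝ) (hf : HasACDeriv b f f') :
    HasACDeriv b (fun t => c * f t) (fun t => c * f' t) :=
  hf.const_smul c

theorem bilinear {g g' : ℝ → F} (B : E →L[ℝ] F →L[ℝ] G)
    (hf : HasACDeriv b f f') (hg : HasACDeriv b g g') :
    HasACDeriv b (fun t => B (f t) (g t)) (fun t => B (f t) (g' t) + B (f' t) (g t)) :=
  ⟨AbsolutelyContinuousOnInterval.bilinear B hf.ac hg.ac, by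
    filter_upwards [hf.ae_deriv, hg.ae_deriv] with t h1 h2 ht
    have := B.hasFDerivAt_of_bilinear (h1 ht).hasFDerivAt (h2 ht).hasFDerivAt
    simpa using this.hasDerivAt⟩

theorem integral [CompleteSpace E] (hf : IntervalIntegrable f' volume 0 b) (hb : 0 ≤ b) (c : E) :
    HasACDeriv b (fun t => c + ∫ τ in (0 : ℝ)..t, f' τ) f' := by
  constructor
  · refine absolutelyContinuousOnInterval_of_dist_le
      (hf.norm.absolutelyContinuousOnInterval_intervalIntegral (c := 0) (by simp)) ?_
    intro x hx y hy
    have hs : ∀ z ∈ uIcc 0 b, IntervalIntegrable f' volume 0 z := fun z hz =>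
      hf.mono_set (uIcc_subset_uIcc (by simp) hz)
    rw [dist_add_left, dist_eq_norm, dist_eq_norm,
      intervalIntegral.integral_interval_sub_left (hs x hx) (hs y hy),
      intervalIntegral.integral_interval_sub_left (hs x hx).norm (hs y hy).norm, Real.norm_eq_abs]
    exact intervalIntegral.norm_integral_le_abs_integral_norm
  · filter_upwards [hf.ae_hasDerivAt_integral] with t ht hm
    refine (ht ?_ 0 (by simp)).const_add c
    rw [uIcc_of_le hb]
    exact Ioo_subset_Icc_self hm

theorem congr (hf : HasACDeriv b f f') (hb : 0 ≤ b) (h : ∀ t ∈ Icc 0 b, f t = g t) :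
    HasACDeriv b g f' := by
  constructor
  · refine absolutelyContinuousOnInterval_of_dist_le hf.ac ?_
    intro x hx y hy
    rw [uIcc_of_le hb] at hx hy
    rw [h x hx, h y hy]
  · filter_upwards [hf.ae_deriv] with t ht hm
    refine (ht hm).congr_of_eventuallyEq ?_
    filter_upwards [isOpen_Ioo.mem_nhds hm] with x hx
    exact (h x (Ioo_subset_Icc_self hx)).symm

theorem of_isPrimitiveOn [CompleteSpace E] {T : EReal} (hf : IsPrimitiveOn T f f') (hb : 0 ≤ b)
    (hbT : (b : EReal) < T) : HasACDeriv b f f' := by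
  refine (integral (hf b hb hbT).1 hb (f 0)).congr hb fun t ht => ?_
  exact (hf t ht.1 (lt_of_le_of_lt (EReal.coe_le_coe_iff.2 ht.2) hbT)).2.symm

theorem of_hasDerivWithinAt {C : ℝ} (hb : 0 ≤ b)
    (hf : ∀ t ∈ Icc 0 b, HasDerivWithinAt f (f' t) (Icc 0 b) t)
    (hC : ∀ t ∈ Icc 0 b, ‖f' t‖ ≤ C) : HasACDeriv b f f' := by
  constructor
  · have hl : LipschitzOnWith C.toNNReal f (Icc 0 b) := by
      refine (convex_Icc 0 b).lipschitzOnWith_of_nnnorm_hasDerivWithin_le hf fun t ht => ?_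
      rw [← NNReal.coe_le_coe]
      exact (hC t ht).trans (Real.le_coe_toNNReal C)
    rw [← uIcc_of_le hb] at hl
    exact hl.absolutelyContinuousOnInterval
  · exact Eventually.of_forall fun t ht =>
      (hf t (Ioo_subset_Icc_self ht)).hasDerivAt (Icc_mem_nhds ht.1 ht.2)

/-- Chain rule for a `C¹` outer function, given through its derivative `k` on the line. -/
theorem comp {f f' : ℝ → ℝ} {K k : ℝ → ℝ} (hf : HasACDeriv b f f')
    (hK : ∀ x, HasDerivAt K (k x) x) (hk : Continuous k) :
    HasACDeriv b (fun t => K (f t)) (fun t => k (f t) * f' t) := by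
  constructor
  · obtain ⟨C, hC⟩ := hf.ac.exists_bound
    obtain ⟨D, hD⟩ := (isCompact_Icc (a := -C) (b := C)).exists_bound_of_continuousOn
      hk.continuousOn
    have hmem : ∀ t ∈ uIcc 0 b, f t ∈ Icc (-C) C := fun t ht => abs_le.1 (hC t ht)
    refine absolutelyContinuousOnInterval_of_dist_le (hf.ac.const_mul D) ?_
    intro x hx y hy
    have h1 := (convex_Icc (-C) C).norm_image_sub_le_of_norm_hasDerivWithin_le
      (fun x _ => (hK x).hasDerivWithinAt) hD (hmem y hy) (hmem x hx)
    rw [dist_eq_norm, dist_eq_norm, ← mul_sub, norm_mul]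
    refine h1.trans ?_
    gcongr
    exact le_abs_self D
  · filter_upwards [hf.ae_deriv] with t ht hm using (hK _).comp t (ht hm)

/-- An absolutely continuous function with almost everywhere nonnegative derivative increases. -/
theorem le_of_deriv_nonneg {f f' : ℝ → ℝ} (hf : HasACDeriv b f f') (hb : 0 ≤ b)
    (h : ∀ t ∈ Ioo 0 b, 0 ≤ f' t) : f 0 ≤ f b := by
  rw [← sub_nonneg, ← hf.ac.integral_deriv_eq_sub]
  refine intervalIntegral.integral_nonneg_of_ae_restrict hb ?_
  have h0 : ∀ᵐ x : ℝ, x ≠ 0 := by simp [ae_iff, measure_singleton]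
  have h1 : ∀ᵐ x : ℝ, x ≠ b := by simp [ae_iff, measure_singleton]
  refine (ae_restrict_iff' measurableSet_Icc).2 ?_
  filter_upwards [hf.ae_deriv, h0, h1] with t ht h0 h1 hm
  have hm' : t ∈ Ioo 0 b := ⟨lt_of_le_of_ne hm.1 (Ne.symm h0), lt_of_le_of_ne hm.2 h1⟩
  rw [(ht hm').deriv]
  exact h t hm'

theorem le_of_deriv_le {f f' g g' : ℝ → ℝ} (hf : HasACDeriv b f f') (hg : HasACDeriv b g g')
    (hb : 0 ≤ b) (h : ∀ t ∈ Ioo 0 b, f' t ≤ g' t) : f b - f 0 ≤ g b - g 0 := by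
  have := (hg.sub hf).le_of_deriv_nonneg hb fun t ht => sub_nonneg.2 (h t ht)
  linarith

end HasACDeriv

end AbsolutelyContinuous

/-- A form of Barbalat's lemma: a function that is square integrable on `[0,∞)` and Lipschitz
there tends to zero. -/
theorem tendsto_zero_of_integral_sq_le {E : Type*} [NormedAddCommGroup E] {f : ℝ → E} {C K : ℝ}
    (hK : ∀ x y, 0 ≤ x → x ≤ y → ‖f y - f x‖ ≤ K * (y - x))
    (hi : ∀ t, 0 ≤ t → IntervalIntegrable (fun τ => ‖f τ‖ ^ 2) volume 0 t)
    (hC : ∀ t, 0 ≤ t → ∫ τ in (0 : ℝ)..t, ‖f τ‖ ^ 2 ≤ C) : Tendsto f atTop (𝓝 0) := by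
  -- The primitive of `‖f‖²`, extended by `0` to negative times, is monotone and bounded.
  set I : ℝ → ℝ := fun t => ∫ τ in (0 : ℝ)..(max 0 t), ‖f τ‖ ^ 2 with hI
  have hsub : ∀ x y, 0 ≤ x → x ≤ y → I y - I x = ∫ τ in x..y, ‖f τ‖ ^ 2 := by
    intro x y hx hxy
    simp only [hI, max_eq_right hx, max_eq_right (hx.trans hxy)]
    exact intervalIntegral.integral_interval_sub_left (hi y (hx.trans hxy)) (hi x hx)
  have hmono : Monotone I := by
    intro x y hxy
    have h1 := hsub (max 0 x) (max 0 y) (le_max_left _ _) (max_le_max le_rfl hxy)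
    have h2 : 0 ≤ ∫ τ in (max 0 x)..(max 0 y), ‖f τ‖ ^ 2 :=
      intervalIntegral.integral_nonneg (max_le_max le_rfl hxy) fun _ _ => by positivity
    have h3 : ∀ z, I (max 0 z) = I z := fun z => by simp [hI]
    rw [h3, h3] at h1
    linarith
  have hlim := tendsto_atTop_ciSup hmono ⟨C, by rintro _ ⟨t, rfl⟩; exact hC _ (le_max_left _ _)⟩
  rw [Metric.tendsto_atTop]
  intro ε hε
  set d : ℝ := ε / (2 * (|K| + 1)) with hd
  have hdpos : 0 < d := by positivity
  have hKd : |K| * d ≤ ε / 2 := by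
    have : (|K| + 1) * d = ε / 2 := by rw [hd]; field_simp
    nlinarith
  have hlim2 : Tendsto (fun t => I (t + d) - I t) atTop (𝓝 0) := by
    simpa using (hlim.comp (tendsto_atTop_add_const_right atTop d tendsto_id)).sub hlim
  have hδ : 0 < d * (ε / 2) ^ 2 := by positivity
  obtain ⟨N, hN⟩ := eventually_atTop.1 ((tendsto_order.1 hlim2).2 _ hδ)
  refine ⟨max 0 N, fun t ht => ?_⟩
  have ht0 : 0 ≤ t := (le_max_left _ _).trans ht
  rw [dist_zero_right]
  by_contra! hcon
  have h1 := hN t ((le_max_right _ _).trans ht)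
  rw [hsub t (t + d) ht0 (by linarith)] at h1
  have h2 : ∫ τ in t..(t + d), (ε / 2) ^ 2 ≤ ∫ τ in t..(t + d), ‖f τ‖ ^ 2 := by
    refine intervalIntegral.integral_mono_on (by linarith) (by simp)
      ((hi t ht0).symm.trans (hi (t + d) (by linarith))) fun τ hτ => ?_
    have h3 := hK t τ ht0 hτ.1
    have h4 : K * (τ - t) ≤ |K| * d := by
      refine (mul_le_mul_of_nonneg_right (le_abs_self K) (by linarith [hτ.1])).trans ?_
      exact mul_le_mul_of_nonneg_left (by linarith [hτ.2]) (abs_nonneg K)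
    have h5 := norm_sub_norm_le (f t) (f τ)
    rw [norm_sub_rev] at h5
    have : ε / 2 ≤ ‖f τ‖ := by linarith
    gcongr
  simp only [intervalIntegral.integral_const, add_sub_cancel_left, smul_eq_mul] at h2
  linarith

/-! ### Quadratic forms -/

section Matrices

variable {m : ℕ}

theorem norm_mulV_le (A : Mat m) (x : Vec m) : ‖mulV A x‖ ≤ ‖A‖ * ‖x‖ :=
  Matrix.l2_opNorm_mulVec A x

theorem mulV_mul (A B : Mat m) (x : Vec m) : mulV (A * B) x = mulV A (mulV B x) := by
  simp [mulV, Matrix.mulVec_mulVec]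

theorem mulV_smul (A : Mat m) (c : ℝ) (x : Vec m) : mulV A (c • x) = c • mulV A x := by
  simp [mulV, Matrix.mulVec_smul]

theorem mulV_add (A : Mat m) (x y : Vec m) : mulV A (x + y) = mulV A x + mulV A y := by
  simp [mulV, Matrix.mulVec_add]

theorem add_mulV (A B : Mat m) (x : Vec m) : mulV (A + B) x = mulV A x + mulV B x := by
  simp [mulV, Matrix.add_mulVec]

theorem inner_mulV (A : Mat m) (x y : Vec m) :
    inner ℝ x (mulV A y) = inner ℝ (mulV A.transpose x) y := by
  simp only [mulV, EuclideanSpace.inner_eq_star_dotProduct, star_trivial]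
  rw [Matrix.mulVec_transpose, dotProduct_comm, Matrix.dotProduct_mulVec, dotProduct_comm]

/-- The matrix-vector product as a continuous bilinear map. -/
noncomputable def mulVL (m : ℕ) : Mat m →L[ℝ] Vec m →L[ℝ] Vec m :=
  LinearMap.mkContinuous₂
    (LinearMap.mk₂ ℝ mulV add_mulV
      (fun c A x => by simp [mulV, Matrix.smul_mulVec]) mulV_add
      fun c A x => mulV_smul A c x) 1
    fun A x => by rw [one_mul]; exact norm_mulV_le A x

@[simp]
theorem mulVL_apply (A : Mat m) (x : Vec m) : mulVL m A x = mulV A x := rfl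

theorem inner_mulV_nonneg {A : Mat m} (hA : A.PosSemidef) (x : Vec m) :
    0 ≤ inner ℝ x (mulV A x) := by
  have := hA.dotProduct_mulVec_nonneg x.ofLp
  rw [mulV, EuclideanSpace.inner_eq_star_dotProduct, dotProduct_comm]
  exact this

/-- Cauchy-Schwarz for the semi-inner product of a positive semidefinite matrix. -/
theorem inner_mulV_sq_le {A : Mat m} (hA : A.PosSemidef) (x y : Vec m) :
    inner ℝ x (mulV A y) ^ 2 ≤ inner ℝ x (mulV A x) * inner ℝ y (mulV A y) := by
  have hT : A.transpose = A := by simpa [Matrix.IsHermitian] using hA.isHermitian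
  have key : ∀ r : ℝ, 0 ≤ inner ℝ y (mulV A y) * (r * r) + 2 * inner ℝ x (mulV A y) * r
      + inner ℝ x (mulV A x) := by
    intro r
    have h := inner_mulV_nonneg hA (x + r • y)
    have hs : inner ℝ y (mulV A x) = inner ℝ x (mulV A y) := by
      rw [inner_mulV A x y, hT, real_inner_comm]
    simp only [mulV_add, mulV_smul, inner_add_left, inner_add_right, real_inner_smul_left,
      real_inner_smul_right, hs] at h
    linarith
  have := discrim_le_zero key
  rw [discrim] at this
  nlinarith

theorem inner_mulV_mem_of_spectrum {X : Mat m} (hX : X.IsHermitian) {lo hi : ℝ}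
    (h : ∀ μ ∈ spectrum ℝ X, μ ∈ Icc lo hi) (x : Vec m) :
    lo * ‖x‖ ^ 2 ≤ inner ℝ x (mulV X x) ∧ inner ℝ x (mulV X x) ≤ hi * ‖x‖ ^ 2 := by
  have hc : ∀ c : ℝ, (algebraMap ℝ (Mat m) c).IsHermitian := fun c => by
    rw [Matrix.IsHermitian, Algebra.algebraMap_eq_smul_one]; simp
  have hm : ∀ c : ℝ, inner ℝ x (mulV (algebraMap ℝ (Mat m) c) x) = c * ‖x‖ ^ 2 := fun c => by
    rw [Algebra.algebraMap_eq_smul_one, mulV, Matrix.smul_mulVec, Matrix.one_mulVec,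
      WithLp.toLp_smul, real_inner_smul_right, WithLp.toLp_ofLp, real_inner_self_eq_norm_sq]
  constructor
  · have hp : (X - algebraMap ℝ (Mat m) lo).PosSemidef := by
      rw [Matrix.posSemidef_iff_isHermitian_and_spectrum_nonneg]
      refine ⟨hX.sub (hc lo), ?_⟩
      rw [← spectrum.sub_singleton_eq]
      rintro _ ⟨μ, hμ, _, rfl, rfl⟩
      exact sub_nonneg.2 (h μ hμ).1
    have h1 := inner_mulV_nonneg hp x
    have h2 := add_mulV (X - algebraMap ℝ (Mat m) lo) (algebraMap ℝ (Mat m) lo) x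
    rw [sub_add_cancel] at h2
    rw [h2, inner_add_right, hm]
    linarith
  · have hp : (algebraMap ℝ (Mat m) hi - X).PosSemidef := by
      rw [Matrix.posSemidef_iff_isHermitian_and_spectrum_nonneg]
      refine ⟨(hc hi).sub hX, ?_⟩
      rw [← spectrum.singleton_sub_eq]
      rintro _ ⟨_, rfl, μ, hμ, rfl⟩
      exact sub_nonneg.2 (h μ hμ).2
    have h1 := inner_mulV_nonneg hp x
    have h2 := add_mulV (algebraMap ℝ (Mat m) hi - X) X x
    rw [sub_add_cancel] at h2
    rw [← hm hi, h2, inner_add_right]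
    linarith

theorem Robot.gain_continuous (rob : Robot m) : Continuous rob.gain := by
  unfold Robot.gain
  simp only [Matrix.inv_def]
  have hd : Continuous fun q => (rob.M q).det := rob.M_continuous.matrix_det
  simp only [Ring.inverse_eq_inv']
  exact (hd.inv₀ fun q => (rob.M_posDef q).det_pos.ne').smul rob.M_continuous.matrix_adjugate

theorem Fault.norm_mat_le (flt : Fault m) {t : ℝ} (ht : 0 ≤ t) : ‖flt.mat t‖ ≤ 1 := by
  rw [Fault.mat, Matrix.l2_opNorm_diagonal]
  refine (pi_norm_le_iff_of_nonneg zero_le_one).2 fun j => ?_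
  have := flt.rho_mem t ht j
  rw [Real.norm_eq_abs, abs_of_pos this.1]
  exact this.2

/-- The input matrix enters the Lyapunov derivative only through its symmetric part, which
`Controllability` bounds from both sides. -/
theorem Controllability.inner_bounds {rob : Robot m} {flt : Fault m} {α : Vec m → ℝ → Mat m}
    {lo hi : ℝ} (hc : Controllability rob flt α lo hi) (q : Vec m) {t : ℝ} (ht : 0 ≤ t)
    (s : Vec m) :
    lo * ‖s‖ ^ 2 ≤ 2 * inner ℝ s (mulV (α q t) (mulV (rob.gain q * flt.mat t) s)) ∧
      2 * inner ℝ s (mulV (α q t) (mulV (rob.gain q * flt.mat t) s)) ≤ hi * ‖s‖ ^ 2 := by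
  have hT : (α q t).transpose = α q t := by
    simpa [Matrix.IsHermitian] using (hc.posDef q t ht).isHermitian
  set P := α q t * rob.gain q * flt.mat t with hP
  have hPT : P.transpose = flt.mat t * (rob.gain q).transpose * α q t := by
    rw [hP, Matrix.transpose_mul, Matrix.transpose_mul, hT, Fault.mat, Matrix.diagonal_transpose,
      Matrix.mul_assoc]
  have hH : (P + P.transpose).IsHermitian := by
    simp [Matrix.IsHermitian, add_comm]
  have hs : inner ℝ s (mulV (P + P.transpose) s)
      = 2 * inner ℝ s (mulV (α q t) (mulV (rob.gain q * flt.mat t) s)) := by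
    rw [add_mulV, inner_add_right, inner_mulV P.transpose, Matrix.transpose_transpose,
      ← mulV_mul, ← Matrix.mul_assoc, real_inner_comm s (mulV P s)]
    exact (two_mul _).symm
  rw [← hs]
  refine inner_mulV_mem_of_spectrum hH (fun μ hμ => hc.eig_mem q t ht μ ?_) s
  rwa [hPT] at hμ

end Matrices

/-! ### Nussbaum functions -/

section Nussbaum

/-- The combination of `∫ h⁺` and `∫ h⁻` that enters the Lyapunov estimate. The function is taken
to be constant to the left of `0`, which makes the primitives differentiable on the whole line and
changes no value at a point of `[0,∞)`. -/
noncomputable def nussInt (h : ℝ → ℝ) (lo hi z : ℝ) : ℝ :=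
  hi * posInt (fun x => h (max 0 x)) z - lo * negInt (fun x => h (max 0 x)) z

/-- The derivative of `nussInt`. -/
noncomputable def nussRate (h : ℝ → ℝ) (lo hi z : ℝ) : ℝ :=
  hi * max 0 (h (max 0 z)) - lo * max 0 (-h (max 0 z))

variable {h : ℝ → ℝ} {lo hi : ℝ}

theorem IsBLNussbaum.continuous_extend {L : EReal} (hN : IsBLNussbaum h L) :
    Continuous fun x => h (max 0 x) :=
  hN.contDiffOn.continuousOn.comp_continuous (by fun_prop) fun x => le_max_left 0 x

theorem continuous_nussRate (hc : Continuous fun x => h (max 0 x)) :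
    Continuous (nussRate h lo hi) := by
  exact ((continuous_const.max hc).const_mul hi).sub ((continuous_const.max hc.neg).const_mul lo)

theorem hasDerivAt_nussInt (hc : Continuous fun x => h (max 0 x)) (z : ℝ) :
    HasDerivAt (nussInt h lo hi) (nussRate h lo hi z) z := by
  have h1 : Continuous fun x => max 0 (h (max 0 x)) := continuous_const.max hc
  have h2 : Continuous fun x => max 0 (-h (max 0 x)) := continuous_const.max hc.neg
  exact ((h1.integral_hasStrictDerivAt 0 z).hasDerivAt.const_mul hi).sub
    ((h2.integral_hasStrictDerivAt 0 z).hasDerivAt.const_mul lo)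

theorem nussInt_eq {z : ℝ} (hz : 0 ≤ z) :
    nussInt h lo hi z = hi * posInt h z - lo * negInt h z := by
  have : ∀ x ∈ uIcc 0 z, max 0 x = x := fun x hx => by
    rw [uIcc_of_le hz] at hx; exact max_eq_right hx.1
  unfold nussInt posInt negInt
  congr 2 <;> exact intervalIntegral.integral_congr fun x hx => by simp only [this x hx]

/-- Where `B / A` exceeds a number larger than `a / b`, the difference `a A - b B` is at most a
negative multiple of `B`, and `B` outgrows every affine function. -/
theorem exists_linear_combination_neg {A B : ℝ → ℝ} {L : EReal} {a b : ℝ} (ha : 0 < a)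
    (hb : 0 < b) (hA : Tendsto (fun z => A z / z) atTop atTop)
    (hB : Tendsto (fun z => B z / z) atTop atTop)
    (hL : L ≤ limsup (fun z => ((B z / A z : ℝ) : EReal)) atTop)
    (hab : ((a / b : ℝ) : EReal) < L) (C c Z : ℝ) :
    ∃ z, Z < z ∧ C + c * z + (a * A z - b * B z) < 0 := by
  obtain ⟨r, hr1, hr2⟩ := EReal.lt_iff_exists_real_btwn.1 (lt_of_lt_of_le hab hL)
  have hr1 : a / b < r := EReal.coe_lt_coe_iff.1 hr1
  have hrpos : 0 < r := (div_pos ha hb).trans hr1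
  have hfreq := Filter.frequently_lt_of_lt_limsup (by isBoundedDefault) hr2
  have hδ : 0 < b - a / r := by
    have := (div_lt_iff₀ hb).1 hr1
    rw [sub_pos, div_lt_iff₀ hrpos]
    linarith
  obtain ⟨z, hz1, ⟨hz2, hz3, hz4⟩, hz5⟩ := (hfreq.and_eventually
    ((((eventually_gt_atTop Z).and ((hA.eventually_gt_atTop 0).and
      (hB.eventually_gt_atTop ((|C| + |c|) / (b - a / r)))))).and
      (eventually_gt_atTop 1))).exists
  refine ⟨z, hz2, ?_⟩
  have hz0 : 0 < z := by linarith
  have hApos : 0 < A z := by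
    have := mul_pos hz3 hz0
    rwa [div_mul_cancel₀ _ hz0.ne'] at this
  have h1 : r * A z < B z := by
    have := EReal.coe_lt_coe_iff.1 hz1
    rwa [lt_div_iff₀ hApos] at this
  have h2 : a * A z < a / r * B z := by
    have := mul_lt_mul_of_pos_left h1 (div_pos ha hrpos)
    rwa [← mul_assoc, div_mul_cancel₀ _ hrpos.ne'] at this
  have h3 : (|C| + |c|) * z < (b - a / r) * B z := by
    rw [div_lt_iff₀ hδ, div_mul_eq_mul_div, lt_div_iff₀ hz0] at hz4
    linarith
  have h4 : C ≤ |C| * z := (le_abs_self C).trans (le_mul_of_one_le_right (abs_nonneg C) hz5.le)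
  have h5 : c * z ≤ |c| * z := mul_le_mul_of_nonneg_right (le_abs_self c) hz0.le
  nlinarith

/-- Whatever the common sign of `lo` and `hi`, the Nussbaum term is somewhere far out more negative
than any prescribed affine function is positive. -/
theorem IsBLNussbaum.exists_nussInt_neg {L : EReal} (hN : IsBLNussbaum h L)
    (hs : 0 < lo * hi) (hL : ((max (lo / hi) (hi / lo) : ℝ) : EReal) < L) (C c Z : ℝ)
    (hZ : 0 ≤ Z) : ∃ z, Z < z ∧ C + c * z + nussInt h lo hi z < 0 := by
  have hle : ∀ {x : ℝ}, x ≤ max (lo / hi) (hi / lo) → (x : EReal) < L := fun hx =>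
    lt_of_le_of_lt (EReal.coe_le_coe_iff.2 hx) hL
  rcases pos_and_pos_or_neg_and_neg_of_mul_pos hs with ⟨h1, h2⟩ | ⟨h1, h2⟩
  · obtain ⟨z, hz, hz'⟩ := exists_linear_combination_neg h2 h1 hN.pos_tendsto hN.neg_tendsto
      hN.neg_limsup (hle (le_max_right _ _)) C c Z
    exact ⟨z, hz, by rwa [nussInt_eq (hZ.trans hz.le)]⟩
  · obtain ⟨z, hz, hz'⟩ := exists_linear_combination_neg (neg_pos.2 h1) (neg_pos.2 h2)
      hN.neg_tendsto hN.pos_tendsto hN.pos_limsup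
      (by rw [neg_div_neg_eq]; exact hle (le_max_left _ _)) C c Z
    refine ⟨z, hz, ?_⟩
    rw [nussInt_eq (hZ.trans hz.le)]
    linarith

end Nussbaum

/-! ### Pointwise bounds on the closed-loop signals -/

section Pointwise

variable {m : ℕ} {rob : Robot m} {flt : Fault m} {ref : Reference m} {bf : BoundFns m}
  {des : Design} {h : ℝ → ℝ} {α : Vec m → ℝ → Mat m} {lo hi : ℝ}

theorem core_nonneg (t : ℝ) (q v : Vec m) : 0 ≤ core ref bf des t q v := by
  have h1 := bf.phi1_nonneg q
  have h2 := bf.phi2_nonneg q v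
  have h3 := bf.phif_nonneg q v
  unfold core
  positivity

/-- The scalar factor `c` in `η = c s`. -/
noncomputable def etaCoeff (ref : Reference m) (bf : BoundFns m) (des : Design) (t : ℝ)
    (q v : Vec m) (th : ℝ) : ℝ :=
  des.k + th * core ref bf des t q v ^ 2
    / (core ref bf des t q v * ‖filt ref des t q v‖ + des.nu t)

theorem eta_eq_smul (t : ℝ) (q v : Vec m) (th : ℝ) :
    eta ref bf des t q v th = etaCoeff ref bf des t q v th • filt ref des t q v := by
  rw [eta, etaCoeff, add_smul]

theorem etaCoeff_nonneg {t : ℝ} (ht : 0 ≤ t) (q v : Vec m) {th : ℝ} (hth : 0 ≤ th) :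
    0 ≤ etaCoeff ref bf des t q v th := by
  have h1 := core_nonneg (ref := ref) (bf := bf) (des := des) t q v
  have h2 := des.nu_nonneg t ht
  have h3 := des.k_pos
  unfold etaCoeff
  positivity

theorem zetaRHS_eq (t : ℝ) (q v : Vec m) (th : ℝ) :
    zetaRHS ref bf des t q v th
      = des.sigma1 * (etaCoeff ref bf des t q v th * ‖filt ref des t q v‖ ^ 2) := by
  rw [zetaRHS, eta_eq_smul, real_inner_smul_right, real_inner_self_eq_norm_sq]

/-- The two adaptive laws are tied together: the adaptive part of `ζ̇` is `θ̂` times the update law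
of `θ̂`. -/
theorem zetaRHS_eq_add (t : ℝ) (q v : Vec m) (th : ℝ) :
    zetaRHS ref bf des t q v th / des.sigma1
      = des.k * ‖filt ref des t q v‖ ^ 2 + th * thetaRHS ref bf des t q v / des.sigma2 := by
  have h1 := des.sigma1_pos.ne'
  have h2 := des.sigma2_pos.ne'
  rw [zetaRHS_eq, mul_div_cancel_left₀ _ h1, etaCoeff, thetaRHS, mul_assoc des.sigma2,
    mul_div_assoc des.sigma2, mul_left_comm th, mul_div_cancel_left₀ _ h2]
  ring

theorem thetaRHS_nonneg {t : ℝ} (ht : 0 ≤ t) (q v : Vec m) : 0 ≤ thetaRHS ref bf des t q v := by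
  have h1 := core_nonneg (ref := ref) (bf := bf) (des := des) t q v
  have h2 := des.nu_nonneg t ht
  have h3 := des.sigma2_pos
  unfold thetaRHS
  positivity

/-- The regularised update law dominates `φ‖s‖` up to the integrable error `ν`. -/
theorem core_mul_norm_le {t : ℝ} (ht : 0 ≤ t) (q v : Vec m) :
    core ref bf des t q v * ‖filt ref des t q v‖
      ≤ des.nu t + thetaRHS ref bf des t q v / des.sigma2 := by
  have h1 := core_nonneg (ref := ref) (bf := bf) (des := des) t q v
  have h2 := des.nu_nonneg t ht
  rw [thetaRHS, mul_assoc des.sigma2, mul_div_assoc, mul_div_cancel_left₀ _ des.sigma2_pos.ne',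
    ← mul_pow]
  set x := core ref bf des t q v * ‖filt ref des t q v‖ with hx
  have hx0 : 0 ≤ x := by positivity
  rcases (add_nonneg hx0 h2).eq_or_lt with h0 | h0
  · rw [← h0]
    simp only [div_zero]
    linarith
  · have : x ^ 2 / (x + des.nu t) = x - x * des.nu t / (x + des.nu t) := by
      field_simp; ring
    have h3 : x * des.nu t / (x + des.nu t) ≤ des.nu t := by
      rw [div_le_iff₀ h0]; nlinarith
    linarith

theorem norm_eta_le {t : ℝ} (ht : 0 ≤ t) (q v : Vec m) {th : ℝ} (hth : 0 ≤ th) :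
    ‖eta ref bf des t q v th‖ ≤ des.k * ‖filt ref des t q v‖ + th * core ref bf des t q v := by
  have h1 := core_nonneg (ref := ref) (bf := bf) (des := des) t q v
  have h2 := des.nu_nonneg t ht
  rw [eta_eq_smul, norm_smul, Real.norm_of_nonneg (etaCoeff_nonneg ht q v hth), etaCoeff, add_mul]
  set φ := core ref bf des t q v
  set n := ‖filt ref des t q v‖
  have hn : 0 ≤ n := norm_nonneg _
  have h3 : φ * n / (φ * n + des.nu t) ≤ 1 := div_le_one_of_le₀ (by linarith) (by positivity)
  have h4 : th * φ ^ 2 / (φ * n + des.nu t) * n = th * φ * (φ * n / (φ * n + des.nu t)) := by ring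
  rw [h4]
  have := mul_le_mul_of_nonneg_left h3 (mul_nonneg hth h1)
  linarith

theorem abs_thetaRHS_le {t : ℝ} (ht : 0 ≤ t) (q v : Vec m) :
    |thetaRHS ref bf des t q v|
      ≤ des.sigma2 * (core ref bf des t q v * ‖filt ref des t q v‖) := by
  have h1 := core_nonneg (ref := ref) (bf := bf) (des := des) t q v
  have h2 := des.nu_nonneg t ht
  have h5 := des.sigma2_pos
  rw [abs_of_nonneg (thetaRHS_nonneg ht q v), thetaRHS]
  set φ := core ref bf des t q v
  set n := ‖filt ref des t q v‖
  have hn : 0 ≤ n := norm_nonneg _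
  have h3 : φ * n / (φ * n + des.nu t) ≤ 1 := div_le_one_of_le₀ (by linarith) (by positivity)
  have h4 : des.sigma2 * φ ^ 2 * n ^ 2 / (φ * n + des.nu t)
      = des.sigma2 * (φ * n) * (φ * n / (φ * n + des.nu t)) := by ring
  rw [h4]
  exact mul_le_of_le_one_right (by positivity) h3

theorem GrowthBounds.exists_norm_le (hg : GrowthBounds rob flt bf α) :
    ∃ a1 : ℝ, 0 < a1 ∧ ∀ q t, 0 ≤ t → ‖α q t‖ ≤ a1 * bf.phi1 q := by
  obtain ⟨_, a1, _, _, h1, _, H⟩ := hg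
  exact ⟨a1, h1, fun q t ht => (H q 0 t ht).2.1⟩

theorem inner_mulV_le (A : Mat m) (x : Vec m) : inner ℝ x (mulV A x) ≤ ‖A‖ * ‖x‖ ^ 2 := by
  refine (real_inner_le_norm _ _).trans ?_
  have := mul_le_mul_of_nonneg_left (norm_mulV_le A x) (norm_nonneg x)
  linarith

/-- On bounded sets of configurations the Lyapunov form controls the norm, although `α` is not
assumed to be uniformly positive definite: `α g ρ` is uniformly nondegenerate and `g ρ` is
bounded there. -/
theorem Controllability.exists_norm_le (hc : Controllability rob flt α lo hi)
    (hg : GrowthBounds rob flt bf α) (Q K : ℝ) :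
    ∃ S : ℝ, ∀ (q s : Vec m) (t : ℝ), 0 ≤ t → ‖q‖ ≤ Q → inner ℝ s (mulV (α q t) s) ≤ K →
      ‖s‖ ≤ S := by
  obtain ⟨a1, ha1, hα⟩ := hg.exists_norm_le
  obtain ⟨P, hP⟩ := (isCompact_closedBall (0 : Vec m) Q).exists_bound_of_continuousOn
    bf.phi1_continuous.continuousOn
  obtain ⟨Γ, hΓ⟩ := (isCompact_closedBall (0 : Vec m) Q).exists_bound_of_continuousOn
    rob.gain_continuous.continuousOn
  obtain ⟨c, hcpos, hcl⟩ : ∃ c : ℝ, 0 < c ∧ ∀ n x : ℝ, 0 ≤ n → lo * n ≤ x → x ≤ hi * n →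
      c * n ≤ |x| := by
    rcases pos_and_pos_or_neg_and_neg_of_mul_pos hc.same_sign with ⟨h1, h2⟩ | ⟨h1, h2⟩
    · exact ⟨lo, h1, fun n x _ hx _ => hx.trans (le_abs_self x)⟩
    · refine ⟨-hi, neg_pos.2 h2, fun n x _ _ hx => ?_⟩
      have := neg_abs_le x
      linarith
  refine ⟨1 + 4 * K * (a1 * P * Γ ^ 2) / c ^ 2, fun q s t ht hq hK => ?_⟩
  have hqm : q ∈ Metric.closedBall (0 : Vec m) Q := by simpa using hq
  have hP' : bf.phi1 q ≤ P := (le_abs_self _).trans (hP q hqm)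
  have hP0 : 0 ≤ P := (bf.phi1_nonneg q).trans hP'
  have hΓ0 : 0 ≤ Γ := (norm_nonneg _).trans (hΓ q hqm)
  set y := mulV (rob.gain q * flt.mat t) s with hy
  have hgρ : ‖rob.gain q * flt.mat t‖ ≤ Γ := by
    refine (norm_mul_le _ _).trans ?_
    calc ‖rob.gain q‖ * ‖flt.mat t‖ ≤ Γ * 1 :=
          mul_le_mul (hΓ q hqm) (flt.norm_mat_le ht) (norm_nonneg _) hΓ0
      _ = Γ := mul_one Γ
  have hyn : ‖y‖ ≤ Γ * ‖s‖ := (norm_mulV_le _ _).trans (by gcongr)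
  have hpsd := (hc.posDef q t ht).posSemidef
  have h0 := inner_mulV_nonneg hpsd s
  have hcs := inner_mulV_sq_le hpsd s y
  obtain ⟨hb1, hb2⟩ := hc.inner_bounds q ht s
  have hl := hcl (‖s‖ ^ 2) _ (by positivity) hb1 hb2
  have h1 : inner ℝ y (mulV (α q t) y) ≤ a1 * P * Γ ^ 2 * ‖s‖ ^ 2 := by
    refine (inner_mulV_le _ _).trans ?_
    calc ‖α q t‖ * ‖y‖ ^ 2 ≤ (a1 * P) * (Γ * ‖s‖) ^ 2 := by
          gcongr
          exact (hα q t ht).trans (by gcongr)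
      _ = _ := by ring
  have h2 : (c * ‖s‖ ^ 2) ^ 2 ≤ 4 * K * (a1 * P * Γ ^ 2) * ‖s‖ ^ 2 := by
    calc (c * ‖s‖ ^ 2) ^ 2 ≤ |2 * inner ℝ s (mulV (α q t) y)| ^ 2 := by gcongr
      _ = 4 * inner ℝ s (mulV (α q t) y) ^ 2 := by rw [sq_abs]; ring
      _ ≤ 4 * (K * (a1 * P * Γ ^ 2 * ‖s‖ ^ 2)) := by
          gcongr
          exact hcs.trans (mul_le_mul hK h1 (inner_mulV_nonneg hpsd y) (h0.trans hK))
      _ = _ := by ring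
  have hK0 : 0 ≤ K := h0.trans hK
  have h3 : ‖s‖ ^ 2 ≤ 4 * K * (a1 * P * Γ ^ 2) / c ^ 2 := by
    rcases (norm_nonneg s).eq_or_lt with hs | hs
    · rw [← hs]
      simp only [ne_eq, OfNat.ofNat_ne_zero, not_false_eq_true, zero_pow]
      positivity
    · rw [le_div_iff₀ (by positivity)]
      have hs2 : 0 < ‖s‖ ^ 2 := by positivity
      refine le_of_mul_le_mul_right ?_ hs2
      linarith
  nlinarith [sq_nonneg (‖s‖ - 1)]

/-- Bounds on the tracking error, on the Lyapunov form and on the two adaptive states bound every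
other signal. -/
theorem exists_signalsBoundedBy (hc : Controllability rob flt α lo hi)
    (hg : GrowthBounds rob flt bf α) (hh : ContinuousOn h (Ici 0)) (E K Z Θ : ℝ) :
    ∃ B : ℝ, ∀ (t : ℝ) (q v : Vec m) (z th : ℝ), 0 ≤ t → ‖err ref t q‖ ≤ E →
      inner ℝ (filt ref des t q v) (mulV (α q t) (filt ref des t q v)) ≤ K →
      0 ≤ z → z ≤ Z → 0 ≤ th → th ≤ Θ → SignalsBoundedBy rob flt ref bf des h B t q v z th := by
  obtain ⟨bq, hbq⟩ := ref.qd_bounded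
  obtain ⟨bv, hbv⟩ := ref.vd_bounded
  obtain ⟨be, hbe⟩ := flt.eps_bounded
  obtain ⟨S, hS⟩ := hc.exists_norm_le hg (E + bq) K
  obtain ⟨af, _, _, haf, _, _, hlump⟩ := id hg
  have hlam := des.lam1_pos
  -- `D` bounds the velocity error, `W` the velocity.
  set D := S + des.lam1 * E with hD
  set W := D + bv with hW
  have hball := isCompact_closedBall (0 : Vec m) (E + bq)
  have hball2 := hball.prod (isCompact_closedBall (0 : Vec m) W)
  obtain ⟨P1, hP1⟩ := hball.exists_bound_of_continuousOn bf.phi1_continuous.continuousOn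
  obtain ⟨Γ, hΓ⟩ := hball.exists_bound_of_continuousOn rob.gain_continuous.continuousOn
  obtain ⟨P2, hP2⟩ := hball2.exists_bound_of_continuousOn bf.phi2_continuous.continuousOn
  obtain ⟨Pf, hPf⟩ := hball2.exists_bound_of_continuousOn bf.phif_continuous.continuousOn
  obtain ⟨H, hH⟩ := (isCompact_Icc (a := (0 : ℝ)) (b := Z)).exists_bound_of_continuousOn
    (hh.mono Icc_subset_Ici_self)
  set Φ := P1 * (des.lam1 * D + Pf + 1) + 1 / 2 * P2 * S with hΦ
  set N := des.k * S + Θ * Φ with hN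
  set U := H * N with hU
  refine ⟨(E + bq) + W + Z + Θ + E + D + S + Φ + N + U + (U + be) + (af * Pf + Γ * U)
    + des.sigma1 * (S * N) + des.sigma2 * (Φ * S), fun t q v z th ht he hK hz0 hz hth0 hth => ?_⟩
  have hE0 : 0 ≤ E := (norm_nonneg _).trans he
  have hq : ‖q‖ ≤ E + bq := by
    have : q = err ref t q + ref.qd t := by simp [err]
    rw [this]
    exact (norm_add_le _ _).trans (add_le_add he (hbq t ht))
  have hs : ‖filt ref des t q v‖ ≤ S := hS q _ t ht hq hK
  have hS0 : 0 ≤ S := (norm_nonneg _).trans hs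
  have hd : ‖errDot ref t v‖ ≤ D := by
    have : errDot ref t v = filt ref des t q v - des.lam1 • err ref t q := by simp [filt]
    rw [this]
    refine (norm_sub_le _ _).trans (add_le_add hs ?_)
    rw [norm_smul, Real.norm_of_nonneg hlam.le]
    gcongr
  have hD0 : 0 ≤ D := (norm_nonneg _).trans hd
  have hv : ‖v‖ ≤ W := by
    have : v = errDot ref t v + ref.vd t := by simp [errDot]
    rw [this]
    exact (norm_add_le _ _).trans (add_le_add hd (hbv t ht))
  have hqm : q ∈ Metric.closedBall (0 : Vec m) (E + bq) := by simpa using hq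
  have hqvm : (q, v) ∈ Metric.closedBall (0 : Vec m) (E + bq) ×ˢ Metric.closedBall (0 : Vec m) W :=
    ⟨hqm, by simpa using hv⟩
  have p1 : bf.phi1 q ≤ P1 := (le_abs_self _).trans (hP1 q hqm)
  have p2 : bf.phi2 q v ≤ P2 := (le_abs_self _).trans (hP2 _ hqvm)
  have pf : bf.phif q v ≤ Pf := (le_abs_self _).trans (hPf _ hqvm)
  have q1 := bf.phi1_nonneg q
  have q2 := bf.phi2_nonneg q v
  have qf := bf.phif_nonneg q v
  have hφ0 := core_nonneg (ref := ref) (bf := bf) (des := des) t q v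
  have hφ : core ref bf des t q v ≤ Φ := by
    unfold core
    rw [norm_smul, Real.norm_of_nonneg hlam.le, hΦ]
    have : 0 ≤ P1 := q1.trans p1
    have : 0 ≤ P2 := q2.trans p2
    gcongr
  have hΦ0 : 0 ≤ Φ := hφ0.trans hφ
  have hη : ‖eta ref bf des t q v th‖ ≤ N := by
    refine (norm_eta_le ht q v hth0).trans ?_
    have := des.k_pos
    have : 0 ≤ Θ := hth0.trans hth
    rw [hN]
    gcongr
  have hN0 : 0 ≤ N := (norm_nonneg _).trans hη
  have hhz : ‖h z‖ ≤ H := hH z ⟨hz0, hz⟩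
  have hH0 : 0 ≤ H := (norm_nonneg _).trans hhz
  have hu : ‖ctrl ref bf des h t q v z th‖ ≤ U := by
    rw [ctrl, norm_smul, hU]
    gcongr
  have hU0 : 0 ≤ U := (norm_nonneg _).trans hu
  have hρ := flt.norm_mat_le ht
  have hΓq := hΓ q hqm
  have hΓ0 : 0 ≤ Γ := (norm_nonneg _).trans hΓq
  have hua : ‖actual flt ref bf des h t q v z th‖ ≤ U + be := by
    refine (norm_add_le _ _).trans (add_le_add ?_ (hbe t ht).le)
    refine (norm_mulV_le _ _).trans ?_
    calc _ ≤ 1 * U := by gcongr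
      _ = U := one_mul U
  have hacc : ‖accRHS rob flt ref bf des h t q v z th‖ ≤ af * Pf + Γ * U := by
    refine (norm_add_le _ _).trans (add_le_add ?_ ?_)
    · exact (hlump q v t ht).1.trans (by gcongr)
    · refine (norm_mulV_le _ _).trans ?_
      have : ‖rob.gain q * flt.mat t‖ ≤ Γ * 1 := (norm_mul_le _ _).trans (by gcongr)
      rw [mul_one] at this
      gcongr
  have hσ1 := des.sigma1_pos
  have hσ2 := des.sigma2_pos
  have hζ : |zetaRHS ref bf des t q v th| ≤ des.sigma1 * (S * N) := by
    rw [zetaRHS, abs_mul, abs_of_pos hσ1]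
    gcongr
    exact (abs_real_inner_le_norm _ _).trans (by gcongr)
  have hθ : |thetaRHS ref bf des t q v| ≤ des.sigma2 * (Φ * S) :=
    (abs_thetaRHS_le ht q v).trans (by gcongr)
  have hz' : |z| ≤ Z := by rwa [abs_of_nonneg hz0]
  have hth' : |th| ≤ Θ := by rwa [abs_of_nonneg hth0]
  have hφ' : |core ref bf des t q v| ≤ Φ := by rwa [abs_of_nonneg hφ0]
  have := norm_nonneg q
  have := norm_nonneg v
  have := abs_nonneg z
  have := abs_nonneg th
  have := norm_nonneg (actual flt ref bf des h t q v z th)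
  have := norm_nonneg (accRHS rob flt ref bf des h t q v z th)
  have := abs_nonneg (zetaRHS ref bf des t q v th)
  have := abs_nonneg (thetaRHS ref bf des t q v)
  clear_value D W Φ N U
  refine ⟨?_, ?_, ?_, ?_, ?_, ?_, ?_, ?_, ?_, ?_, ?_, ?_, ?_, ?_⟩ <;> linarith

end Pointwise

/-! ### Lyapunov estimates along closed-loop solutions -/

section Dynamics

variable {m : ℕ} {rob : Robot m} {flt : Fault m} {ref : Reference m} {bf : BoundFns m}
  {des : Design} {h : ℝ → ℝ} {α : Vec m → ℝ → Mat m} {lo hi : ℝ}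

/-- The real inner product as a continuous bilinear map. -/
noncomputable def innerBilin (E : Type*) [NormedAddCommGroup E] [InnerProductSpace ℝ E] :
    E →L[ℝ] E →L[ℝ] ℝ :=
  LinearMap.mkContinuous₂ (innerₗ E) 1 fun x y => by
    rw [one_mul]; exact norm_inner_le_norm x y

@[simp]
theorem innerBilin_apply {E : Type*} [NormedAddCommGroup E] [InnerProductSpace ℝ E] (x y : E) :
    innerBilin E x y = inner ℝ x y := rfl

theorem HasACDeriv.norm_sq {E : Type*} [NormedAddCommGroup E] [InnerProductSpace ℝ E] {b : ℝ}
    {f f' : ℝ → E} (hf : HasACDeriv b f f') :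
    HasACDeriv b (fun t => ‖f t‖ ^ 2) (fun t => 2 * inner ℝ (f t) (f' t)) := by
  have := hf.bilinear (innerBilin E) hf
  simp only [innerBilin_apply, real_inner_self_eq_norm_sq] at this
  refine this.congr_deriv fun t _ => ?_
  rw [real_inner_comm (f t) (f' t)]
  ring

theorem HasACDeriv.sq {b : ℝ} {f f' : ℝ → ℝ} (hf : HasACDeriv b f f') :
    HasACDeriv b (fun t => f t ^ 2) (fun t => 2 * f t * f' t) :=
  hf.comp (K := fun x => x ^ 2) (k := fun x => 2 * x)
    (fun x => by simpa using hasDerivAt_pow 2 x) (by fun_prop)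

/-- The terms of the Lyapunov derivative that do not contain the control are absorbed by `φ‖s‖`,
the control term by the Nussbaum rate. -/
theorem exists_lyapunov_rate_le (hc : Controllability rob flt α lo hi)
    (hg : GrowthBounds rob flt bf α) (ref : Reference m) (des : Design) (h : ℝ → ℝ) :
    ∃ θ : ℝ, 0 ≤ θ ∧ ∀ (t : ℝ) (q v : Vec m) (z th : ℝ), 0 ≤ t → 0 ≤ z → 0 ≤ th →
      2 * inner ℝ (filt ref des t q v) (mulV (α q t)
          (des.lam1 • (v - ref.vd t) + (accRHS rob flt ref bf des h t q v z th - ref.ad t)))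
        + inner ℝ (filt ref des t q v) (mulV
          (fderivWithin ℝ (fun p : Vec m × ℝ => α p.1 p.2) (dom m) (q, t) (v, 1))
          (filt ref des t q v))
      ≤ 2 * θ * (des.nu t + thetaRHS ref bf des t q v / des.sigma2)
        + 1 / des.sigma1 * (nussRate h lo hi z * zetaRHS ref bf des t q v th) := by
  obtain ⟨af, a1, a2, haf, ha1, ha2, H⟩ := hg
  obtain ⟨b, hb⟩ := ref.ad_bounded
  have hb0 : 0 ≤ b := (norm_nonneg _).trans (hb 0 le_rfl)
  refine ⟨a1 * (1 + af + b) + a2, by positivity, fun t q v z th ht hz hth => ?_⟩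
  obtain ⟨H1, H2, H3⟩ := H q v t ht
  set θ := a1 * (1 + af + b) + a2 with hθ
  have hθ0 : 0 ≤ θ := by positivity
  set s := filt ref des t q v with hs
  set A' := fderivWithin ℝ (fun p : Vec m × ℝ => α p.1 p.2) (dom m) (q, t) (v, 1)
  set x := des.lam1 • (v - ref.vd t) with hx
  have p1 := bf.phi1_nonneg q
  have p2 := bf.phi2_nonneg q v
  have pf := bf.phif_nonneg q v
  have hc0 := etaCoeff_nonneg (ref := ref) (bf := bf) (des := des) ht q v hth
  set c := etaCoeff ref bf des t q v th with hcdef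
  set w := inner ℝ s (mulV (α q t) (mulV (rob.gain q * flt.mat t) s)) with hw
  have hsplit : inner ℝ s (mulV (α q t) (x + (accRHS rob flt ref bf des h t q v z th - ref.ad t)))
      = inner ℝ s (mulV (α q t) (x + lumped rob flt q v t - ref.ad t)) + h z * c * w := by
    have : x + (accRHS rob flt ref bf des h t q v z th - ref.ad t)
        = (x + lumped rob flt q v t - ref.ad t)
          + (h z * c) • mulV (rob.gain q * flt.mat t) s := by
      rw [accRHS, ctrl, eta_eq_smul, smul_smul, mulV_smul]
      abel
    rw [this, mulV_add, inner_add_right, mulV_smul, real_inner_smul_right]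
  have hfree : inner ℝ s (mulV (α q t) (x + lumped rob flt q v t - ref.ad t))
      ≤ ‖s‖ * (a1 * (1 + af + b) * (bf.phi1 q * (‖x‖ + bf.phif q v + 1))) := by
    refine (real_inner_le_norm _ _).trans (mul_le_mul_of_nonneg_left ?_ (norm_nonneg s))
    refine (norm_mulV_le _ _).trans ?_
    have hn : ‖x + lumped rob flt q v t - ref.ad t‖ ≤ ‖x‖ + af * bf.phif q v + b :=
      (norm_sub_le _ _).trans (add_le_add ((norm_add_le _ _).trans (by gcongr)) (hb t ht))
    have hn2 : ‖x‖ + af * bf.phif q v + b ≤ (1 + af + b) * (‖x‖ + bf.phif q v + 1) := by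
      have := norm_nonneg x
      have h1 : 0 ≤ (af + b) * ‖x‖ := by positivity
      have h2 : 0 ≤ (1 + b) * bf.phif q v := by positivity
      linarith
    calc _ ≤ (a1 * bf.phi1 q) * ((1 + af + b) * (‖x‖ + bf.phif q v + 1)) :=
          mul_le_mul H2 (hn.trans hn2) (norm_nonneg _) (by positivity)
      _ = _ := by ring
  have hA' : inner ℝ s (mulV A' s) ≤ a2 * bf.phi2 q v * ‖s‖ ^ 2 :=
    (inner_mulV_le _ _).trans (by gcongr)
  have hφ : 2 * (‖s‖ * (a1 * (1 + af + b) * (bf.phi1 q * (‖x‖ + bf.phif q v + 1))))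
      + a2 * bf.phi2 q v * ‖s‖ ^ 2 ≤ 2 * θ * (core ref bf des t q v * ‖s‖) := by
    have hcore : core ref bf des t q v
      = bf.phi1 q * (‖x‖ + bf.phif q v + 1) + 1 / 2 * bf.phi2 q v * ‖s‖ := rfl
    rw [hcore, hθ]
    have h1 : 0 ≤ a2 * (‖s‖ * (bf.phi1 q * (‖x‖ + bf.phif q v + 1))) := by positivity
    have h2 : 0 ≤ a1 * (1 + af + b) * (bf.phi2 q v * ‖s‖ ^ 2) := by positivity
    linarith
  have hcore := mul_le_mul_of_nonneg_left
    (core_mul_norm_le (ref := ref) (bf := bf) (des := des) ht q v) (mul_nonneg zero_le_two hθ0)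
  have hctl : 2 * (h z * c * w) ≤ 1 / des.sigma1
      * (nussRate h lo hi z * zetaRHS ref bf des t q v th) := by
    obtain ⟨w1, w2⟩ := hc.inner_bounds q ht s
    have hσ := des.sigma1_pos.ne'
    have e1 : 1 / des.sigma1 * (nussRate h lo hi z * zetaRHS ref bf des t q v th)
        = c * (nussRate h lo hi z * ‖s‖ ^ 2) := by
      rw [zetaRHS_eq]
      field_simp
      rfl
    have e2 : h z * (2 * w) ≤ nussRate h lo hi z * ‖s‖ ^ 2 := by
      rw [nussRate, max_eq_right hz]
      rcases le_total 0 (h z) with hp | hp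
      · rw [max_eq_right hp, max_eq_left (neg_nonpos.2 hp)]
        nlinarith [mul_le_mul_of_nonneg_left w2 hp]
      · rw [max_eq_left hp, max_eq_right (neg_nonneg.2 hp)]
        nlinarith [mul_le_mul_of_nonneg_left w1 (neg_nonneg.2 hp)]
    rw [e1]
    nlinarith [mul_le_mul_of_nonneg_left e2 hc0]
  rw [hsplit]
  linarith

theorem coe_lt_of_le {T : EReal} {t b : ℝ} (hbT : (b : EReal) < T) (htb : t ≤ b) :
    (t : EReal) < T :=
  lt_of_le_of_lt (EReal.coe_le_coe_iff.2 htb) hbT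

namespace IsClosedLoop

variable {T : EReal} {q v : ℝ → Vec m} {z th : ℝ → ℝ} {b : ℝ}

theorem theta_mono (hs : IsClosedLoop rob flt ref bf des h T q v z th) (hb : 0 ≤ b)
    (hbT : (b : EReal) < T) : th 0 ≤ th b :=
  (HasACDeriv.of_isPrimitiveOn hs.theta_eq hb hbT).le_of_deriv_nonneg hb
    fun _ ht => thetaRHS_nonneg ht.1.le _ _

theorem theta_nonneg (hs : IsClosedLoop rob flt ref bf des h T q v z th) (hb : 0 ≤ b)
    (hbT : (b : EReal) < T) : 0 ≤ th b :=
  hs.theta_init.trans (hs.theta_mono hb hbT)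

theorem zeta_mono (hs : IsClosedLoop rob flt ref bf des h T q v z th) (hb : 0 ≤ b)
    (hbT : (b : EReal) < T) : z 0 ≤ z b := by
  refine (HasACDeriv.of_isPrimitiveOn hs.zeta_eq hb hbT).le_of_deriv_nonneg hb fun t ht => ?_
  rw [zetaRHS_eq]
  have h1 := etaCoeff_nonneg (ref := ref) (bf := bf) (des := des) ht.1.le (q t) (v t)
    (hs.theta_nonneg ht.1.le (coe_lt_of_le hbT ht.2.le))
  have := des.sigma1_pos
  positivity

theorem zeta_nonneg (hs : IsClosedLoop rob flt ref bf des h T q v z th) (hb : 0 ≤ b)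
    (hbT : (b : EReal) < T) : 0 ≤ z b :=
  hs.zeta_init.trans (hs.zeta_mono hb hbT)

theorem hasACDeriv_vel (hs : IsClosedLoop rob flt ref bf des h T q v z th) (hb : 0 ≤ b)
    (hbT : (b : EReal) < T) :
    HasACDeriv b v fun t => accRHS rob flt ref bf des h t (q t) (v t) (z t) (th t) :=
  .of_isPrimitiveOn hs.vel_eq hb hbT

theorem continuousOn_vel (hs : IsClosedLoop rob flt ref bf des h T q v z th) (hb : 0 ≤ b)
    (hbT : (b : EReal) < T) : ContinuousOn v (Icc 0 b) :=
  (hs.hasACDeriv_vel hb hbT).continuousOn hb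

theorem hasACDeriv_pos (hs : IsClosedLoop rob flt ref bf des h T q v z th) (hb : 0 ≤ b)
    (hbT : (b : EReal) < T) : HasACDeriv b q v :=
  .of_isPrimitiveOn hs.pos_eq hb hbT

/-- The velocity is continuous, so the position is differentiable at every time. -/
theorem hasDerivWithinAt_pos (hs : IsClosedLoop rob flt ref bf des h T q v z th) (hb : 0 ≤ b)
    (hbT : (b : EReal) < T) {t : ℝ} (ht : t ∈ Icc 0 b) :
    HasDerivWithinAt q (v t) (Icc 0 b) t := by
  have hv := hs.continuousOn_vel hb hbT
  set w : ℝ → Vec m := fun τ => v (max 0 (min b τ)) with hw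
  have hwv : ∀ τ ∈ Icc 0 b, w τ = v τ := fun τ hτ => by
    rw [hw]; simp only [min_eq_right hτ.2, max_eq_right hτ.1]
  have hwc : Continuous w := hv.comp_continuous (by fun_prop)
    fun τ => ⟨le_max_left _ _, max_le hb (min_le_left _ _)⟩
  have hd : HasDerivAt (fun x => q 0 + ∫ τ in (0 : ℝ)..x, w τ) (v t) t := by
    rw [← hwv t ht]
    exact (hwc.integral_hasStrictDerivAt 0 t).hasDerivAt.const_add _
  have hq : ∀ x ∈ Icc 0 b, q x = q 0 + ∫ τ in (0 : ℝ)..x, w τ := fun x hx => by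
    rw [(hs.pos_eq x hx.1 (coe_lt_of_le hbT hx.2)).2]
    congr 1
    refine intervalIntegral.integral_congr fun τ hτ => ?_
    rw [uIcc_of_le hx.1] at hτ
    exact (hwv τ ⟨hτ.1, hτ.2.trans hx.2⟩).symm
  exact hd.hasDerivWithinAt.congr hq (hq t ht)

theorem hasACDeriv_err (hs : IsClosedLoop rob flt ref bf des h T q v z th) (hb : 0 ≤ b)
    (hbT : (b : EReal) < T) :
    HasACDeriv b (fun t => err ref t (q t)) fun t => v t - ref.vd t := by
  obtain ⟨C, hC⟩ := ref.vd_bounded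
  exact (hs.hasACDeriv_pos hb hbT).sub (.of_hasDerivWithinAt hb
    (fun t ht => (ref.qd_deriv t ht.1).mono Icc_subset_Ici_self) fun t ht => hC t ht.1)

theorem hasACDeriv_filt (hs : IsClosedLoop rob flt ref bf des h T q v z th) (hb : 0 ≤ b)
    (hbT : (b : EReal) < T) :
    HasACDeriv b (fun t => filt ref des t (q t) (v t)) fun t => des.lam1 • (v t - ref.vd t)
      + (accRHS rob flt ref bf des h t (q t) (v t) (z t) (th t) - ref.ad t) := by
  obtain ⟨C, hC⟩ := ref.ad_bounded
  exact ((hs.hasACDeriv_err hb hbT).const_smul des.lam1).add ((hs.hasACDeriv_vel hb hbT).sub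
    (.of_hasDerivWithinAt hb
      (fun t ht => (ref.vd_deriv t ht.1).mono Icc_subset_Ici_self) fun t ht => hC t ht.1))

/-- Although `α` is merely differentiable, it is absolutely continuous along a motion: its
derivative there is bounded through `φ₂`. -/
theorem hasACDeriv_alpha (hs : IsClosedLoop rob flt ref bf des h T q v z th)
    (hc : Controllability rob flt α lo hi) (hg : GrowthBounds rob flt bf α) (hb : 0 ≤ b)
    (hbT : (b : EReal) < T) :
    HasACDeriv b (fun t => α (q t) t) fun t =>
      fderivWithin ℝ (fun p : Vec m × ℝ => α p.1 p.2) (dom m) (q t, t) (v t, 1) := by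
  obtain ⟨af, a1, a2, _, _, _, H⟩ := hg
  have hqc := (hs.hasACDeriv_pos hb hbT).continuousOn hb
  have hvc := hs.continuousOn_vel hb hbT
  obtain ⟨C, hC⟩ := isCompact_Icc.exists_bound_of_continuousOn
    ((bf.phi2_continuous.comp_continuousOn (hqc.prodMk hvc)).const_smul a2)
  refine .of_hasDerivWithinAt hb (fun t ht => ?_)
    fun t ht => (H (q t) (v t) t ht.1).2.2.trans ((le_abs_self _).trans (hC t ht))
  have h1 : HasDerivWithinAt (fun t => (q t, t)) (v t, (1 : ℝ)) (Icc 0 b) t :=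
    (hs.hasDerivWithinAt_pos hb hbT ht).prodMk (hasDerivWithinAt_id t _)
  have h2 : HasFDerivWithinAt (fun p : Vec m × ℝ => α p.1 p.2)
      (fderivWithin ℝ (fun p : Vec m × ℝ => α p.1 p.2) (dom m) (q t, t)) (dom m)
      ((fun t => (q t, t)) t) :=
    (hc.differentiable (q t, t) ⟨mem_univ _, ht.1⟩).hasFDerivWithinAt
  exact h2.comp_hasDerivWithinAt (f := fun t => (q t, t)) t h1 fun x hx => ⟨mem_univ _, hx.1⟩

/-- The quadratic form `sᵀ α s` along a solution, that is, twice the Lyapunov function. -/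
theorem hasACDeriv_lyapunov (hs : IsClosedLoop rob flt ref bf des h T q v z th)
    (hc : Controllability rob flt α lo hi) (hg : GrowthBounds rob flt bf α) (hb : 0 ≤ b)
    (hbT : (b : EReal) < T) :
    HasACDeriv b
      (fun t => inner ℝ (filt ref des t (q t) (v t))
        (mulV (α (q t) t) (filt ref des t (q t) (v t))))
      fun t => 2 * inner ℝ (filt ref des t (q t) (v t)) (mulV (α (q t) t)
          (des.lam1 • (v t - ref.vd t)
            + (accRHS rob flt ref bf des h t (q t) (v t) (z t) (th t) - ref.ad t)))
        + inner ℝ (filt ref des t (q t) (v t)) (mulV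
          (fderivWithin ℝ (fun p : Vec m × ℝ => α p.1 p.2) (dom m) (q t, t) (v t, 1))
          (filt ref des t (q t) (v t))) := by
  have hf := hs.hasACDeriv_filt hb hbT
  have hA := hs.hasACDeriv_alpha hc hg hb hbT
  refine (hf.bilinear (innerBilin _) (hA.bilinear (mulVL m) hf)).congr_deriv fun t ht => ?_
  have hT : (α (q t) t).transpose = α (q t) t := by
    simpa [Matrix.IsHermitian] using (hc.posDef (q t) t ht.1.le).isHermitian
  simp only [innerBilin_apply, mulVL_apply]
  rw [inner_add_right, inner_mulV (α (q t) t) _ (filt ref des t (q t) (v t)), hT,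
    real_inner_comm (filt ref des t (q t) (v t))]
  ring

/-- Integrated form of the Lyapunov estimate. The constant depends only on the plant. -/
theorem exists_lyapunov_le (hc : Controllability rob flt α lo hi)
    (hg : GrowthBounds rob flt bf α) (hh : Continuous fun x => h (max 0 x)) (ref : Reference m)
    (des : Design) :
    ∃ θ : ℝ, 0 ≤ θ ∧ ∀ (T : EReal) (q v : ℝ → Vec m) (z th : ℝ → ℝ) (b : ℝ),
      IsClosedLoop rob flt ref bf des h T q v z th → 0 ≤ b → (b : EReal) < T →
    inner ℝ (filt ref des b (q b) (v b)) (mulV (α (q b) b) (filt ref des b (q b) (v b)))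
      ≤ inner ℝ (filt ref des 0 (q 0) (v 0)) (mulV (α (q 0) 0) (filt ref des 0 (q 0) (v 0)))
        + 2 * θ * ((∫ τ in (0 : ℝ)..b, des.nu τ) + (th b - th 0) / des.sigma2)
        + 1 / des.sigma1 * (nussInt h lo hi (z b) - nussInt h lo hi (z 0)) := by
  obtain ⟨θ, hθ0, hθ⟩ := exists_lyapunov_rate_le hc hg ref des h
  refine ⟨θ, hθ0, fun T q v z th b hs hb hbT => ?_⟩
  have hν : IntervalIntegrable des.nu volume 0 b := by
    rw [intervalIntegrable_iff_integrableOn_Icc_of_le hb]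
    exact des.nu_integrable.mono_set Icc_subset_Ici_self
  have hth : HasACDeriv b th _ := .of_isPrimitiveOn hs.theta_eq hb hbT
  have hz : HasACDeriv b z _ := .of_isPrimitiveOn hs.zeta_eq hb hbT
  have hG := (((HasACDeriv.integral hν hb 0).add (hth.const_mul (1 / des.sigma2))).const_mul
    (2 * θ)).add ((hz.comp (hasDerivAt_nussInt (lo := lo) (hi := hi) hh)
      (continuous_nussRate hh)).const_mul (1 / des.sigma1))
  have := (hs.hasACDeriv_lyapunov hc hg hb hbT).le_of_deriv_le hG hb fun t ht => by
    have htT := coe_lt_of_le hbT ht.2.le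
    refine (hθ t _ _ _ _ ht.1.le (hs.zeta_nonneg ht.1.le htT)
      (hs.theta_nonneg ht.1.le htT)).trans_eq ?_
    ring
  simp only [intervalIntegral.integral_same] at this
  have e : (th b - th 0) / des.sigma2 = 1 / des.sigma2 * th b - 1 / des.sigma2 * th 0 := by ring
  rw [e]
  linarith

theorem intervalIntegrable_filt_sq (hs : IsClosedLoop rob flt ref bf des h T q v z th)
    (hb : 0 ≤ b) (hbT : (b : EReal) < T) :
    IntervalIntegrable (fun t => ‖filt ref des t (q t) (v t)‖ ^ 2) volume 0 b := by
  refine ContinuousOn.intervalIntegrable ?_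
  rw [uIcc_of_le hb]
  exact ((hs.hasACDeriv_filt hb hbT).continuousOn hb).norm.pow 2

theorem intervalIntegrable_err_sq (hs : IsClosedLoop rob flt ref bf des h T q v z th)
    (hb : 0 ≤ b) (hbT : (b : EReal) < T) :
    IntervalIntegrable (fun t => ‖err ref t (q t)‖ ^ 2) volume 0 b := by
  refine ContinuousOn.intervalIntegrable ?_
  rw [uIcc_of_le hb]
  exact ((hs.hasACDeriv_err hb hbT).continuousOn hb).norm.pow 2

/-- The gain `ζ` pays for the energy of the filtered error and for the growth of `θ̂`. -/
theorem energy_le (hs : IsClosedLoop rob flt ref bf des h T q v z th)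
    (hb : 0 ≤ b) (hbT : (b : EReal) < T) :
    th b ^ 2 / (2 * des.sigma2) + des.k * ∫ τ in (0 : ℝ)..b, ‖filt ref des τ (q τ) (v τ)‖ ^ 2
      ≤ th 0 ^ 2 / (2 * des.sigma2) + (z b - z 0) / des.sigma1 := by
  have hth : HasACDeriv b th _ := .of_isPrimitiveOn hs.theta_eq hb hbT
  have hz : HasACDeriv b z _ := .of_isPrimitiveOn hs.zeta_eq hb hbT
  have hF := (hth.sq.const_mul (1 / (2 * des.sigma2))).add
    ((HasACDeriv.integral (hs.intervalIntegrable_filt_sq hb hbT) hb 0).const_mul des.k)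
  have h2 := des.sigma2_pos.ne'
  have := hF.le_of_deriv_le (hz.const_mul (1 / des.sigma1)) hb fun t ht => by
    rw [one_div_mul_eq_div, one_div_mul_eq_div, zetaRHS_eq_add]
    apply le_of_eq
    field_simp
    ring
  simp only [intervalIntegral.integral_same, mul_zero, add_zero, zero_add,
    one_div_mul_eq_div] at this
  rw [sub_div]
  linarith

theorem err_le (hs : IsClosedLoop rob flt ref bf des h T q v z th)
    (hb : 0 ≤ b) (hbT : (b : EReal) < T) :
    ‖err ref b (q b)‖ ^ 2 + des.lam1 * ∫ τ in (0 : ℝ)..b, ‖err ref τ (q τ)‖ ^ 2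
      ≤ ‖err ref 0 (q 0)‖ ^ 2
        + 1 / des.lam1 * ∫ τ in (0 : ℝ)..b, ‖filt ref des τ (q τ) (v τ)‖ ^ 2 := by
  have hlam := des.lam1_pos
  have hF := (hs.hasACDeriv_err hb hbT).norm_sq.add
    ((HasACDeriv.integral (hs.intervalIntegrable_err_sq hb hbT) hb 0).const_mul des.lam1)
  have hG := (HasACDeriv.integral (hs.intervalIntegrable_filt_sq hb hbT) hb 0).const_mul
    (1 / des.lam1)
  have := hF.le_of_deriv_le hG hb fun t ht => by
    set e := err ref t (q t)
    have hv : v t - ref.vd t = filt ref des t (q t) (v t) - des.lam1 • e := by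
      simp [filt, errDot, e]
    rw [hv, inner_sub_right, real_inner_smul_right, real_inner_self_eq_norm_sq]
    set s := filt ref des t (q t) (v t)
    have h1 := real_inner_le_norm e s
    -- Young's inequality with weight `λ₁`
    have h2 : 2 * (‖e‖ * ‖s‖) ≤ des.lam1 * ‖e‖ ^ 2 + 1 / des.lam1 * ‖s‖ ^ 2 := by
      have h3 : des.lam1 * ‖e‖ ^ 2 + 1 / des.lam1 * ‖s‖ ^ 2 - 2 * (‖e‖ * ‖s‖)
          = 1 / des.lam1 * (des.lam1 * ‖e‖ - ‖s‖) ^ 2 := by field_simp; ring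
      have h4 : 0 ≤ 1 / des.lam1 * (des.lam1 * ‖e‖ - ‖s‖) ^ 2 := by positivity
      linarith
    linarith
  simp only [intervalIntegral.integral_same, mul_zero, add_zero, zero_add] at this
  linarith

end IsClosedLoop

end Dynamics

/-! ### Uniform bounds -/

section Uniform

variable {m : ℕ} {rob : Robot m} {flt : Fault m} {ref : Reference m} {bf : BoundFns m}
  {des : Design} {h : ℝ → ℝ} {α : Vec m → ℝ → Mat m} {lo hi : ℝ}

theorem Design.integral_nu_le (des : Design) {b : ℝ} (hb : 0 ≤ b) :
    ∫ τ in (0 : ℝ)..b, des.nu τ ≤ ∫ τ in Ici 0, des.nu τ := by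
  rw [intervalIntegral.integral_of_le hb]
  refine setIntegral_mono_set des.nu_integrable ?_
    (LE.le.eventuallyLE fun x hx => le_of_lt hx.1)
  exact (ae_restrict_iff' measurableSet_Ici).2 (Eventually.of_forall des.nu_nonneg)

/-- For initial data in a ball the Lyapunov form starts below a common level. -/
theorem exists_initial_lyapunov_le (hg : GrowthBounds rob flt bf α) (ref : Reference m)
    (des : Design) (R : ℝ) :
    ∃ K : ℝ, ∀ q v : Vec m, ‖q‖ ≤ R → ‖v‖ ≤ R →
      ‖err ref 0 q‖ ≤ K ∧
        inner ℝ (filt ref des 0 q v) (mulV (α q 0) (filt ref des 0 q v)) ≤ K := by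
  obtain ⟨a1, ha1, hα⟩ := hg.exists_norm_le
  obtain ⟨P, hP⟩ := (isCompact_closedBall (0 : Vec m) R).exists_bound_of_continuousOn
    bf.phi1_continuous.continuousOn
  have hlam := des.lam1_pos
  set E := R + ‖ref.qd 0‖ with hE
  set S := des.lam1 * E + (R + ‖ref.vd 0‖) with hS
  refine ⟨E + a1 * P * S ^ 2, fun q v hq hv => ?_⟩
  have hR : 0 ≤ R := (norm_nonneg q).trans hq
  have hP' : bf.phi1 q ≤ P := (le_abs_self _).trans (hP q (by simpa using hq))
  have hP0 : 0 ≤ P := (bf.phi1_nonneg q).trans hP'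
  have hE0 : 0 ≤ E := by positivity
  have he : ‖err ref 0 q‖ ≤ E := (norm_sub_le _ _).trans (add_le_add hq le_rfl)
  have hs : ‖filt ref des 0 q v‖ ≤ S := by
    refine (norm_add_le _ _).trans (add_le_add ?_ ((norm_sub_le _ _).trans (by gcongr)))
    rw [norm_smul, Real.norm_of_nonneg hlam.le]
    gcongr
  have hV : inner ℝ (filt ref des 0 q v) (mulV (α q 0) (filt ref des 0 q v))
      ≤ a1 * P * S ^ 2 := by
    refine (inner_mulV_le _ _).trans ?_
    have : ‖α q 0‖ ≤ a1 * P := (hα q 0 le_rfl).trans (by gcongr)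
    gcongr
  have : 0 ≤ a1 * P * S ^ 2 := by positivity
  constructor <;> linarith

/-- The Nussbaum gain `ζ` cannot pass a level at which the Lyapunov estimate would force the
positive form `sᵀ α s` to be negative. -/
theorem exists_zeta_le {L : EReal} (hN : IsBLNussbaum h L)
    (hc : Controllability rob flt α lo hi)
    (hL : ((max (lo / hi) (hi / lo) : ℝ) : EReal) < L) (hg : GrowthBounds rob flt bf α)
    (ref : Reference m) (des : Design) (R : ℝ) :
    ∃ Z K : ℝ, ∀ (T : EReal) (q v : ℝ → Vec m) (z th : ℝ → ℝ),
      IsClosedLoop rob flt ref bf des h T q v z th →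
      ‖q 0‖ ≤ R → ‖v 0‖ ≤ R → z 0 ≤ R → th 0 ≤ R →
      ∀ b : ℝ, 0 ≤ b → (b : EReal) < T → z b ≤ Z ∧
        inner ℝ (filt ref des b (q b) (v b)) (mulV (α (q b) b) (filt ref des b (q b) (v b)))
          ≤ K := by
  obtain ⟨θ, hθ0, hθ⟩ := IsClosedLoop.exists_lyapunov_le hc hg hN.continuous_extend ref des
  obtain ⟨V0, hV0⟩ := exists_initial_lyapunov_le hg ref des R
  have hDc : Continuous (nussInt h lo hi) := continuous_iff_continuousAt.2 fun z =>
    (hasDerivAt_nussInt hN.continuous_extend z).continuousAt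
  obtain ⟨D0, hD0⟩ := (isCompact_Icc (a := (0 : ℝ)) (b := R)).exists_bound_of_continuousOn
    hDc.continuousOn
  have hσ1 := des.sigma1_pos
  have hσ2 := des.sigma2_pos
  set N := ∫ τ in Ici 0, des.nu τ
  set C := des.sigma1 * (V0 + 2 * θ * N + (θ ^ 2 + R ^ 2) / des.sigma2) + D0 with hC
  -- Scaled by `σ₁`, the form is bounded by a function of `ζ` alone.
  have key : ∀ (T : EReal) (q v : ℝ → Vec m) (z th : ℝ → ℝ),
      IsClosedLoop rob flt ref bf des h T q v z th →
      ‖q 0‖ ≤ R → ‖v 0‖ ≤ R → z 0 ≤ R → th 0 ≤ R → ∀ b : ℝ, 0 ≤ b → (b : EReal) < T →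
      des.sigma1 * inner ℝ (filt ref des b (q b) (v b))
        (mulV (α (q b) b) (filt ref des b (q b) (v b)))
        ≤ C + 2 * z b + nussInt h lo hi (z b) := by
    intro T q v z th hs hq hv hz hth b hb hbT
    have h1 := hθ T q v z th b hs hb hbT
    have h2 := hs.energy_le hb hbT
    have h3 := (hV0 _ _ hq hv).2
    have h4 := des.integral_nu_le hb
    have h5 : -nussInt h lo hi (z 0) ≤ D0 :=
      (neg_le_abs _).trans (hD0 _ ⟨hs.zeta_init, hz⟩)
    have h6 : 0 ≤ des.k * ∫ τ in (0 : ℝ)..b, ‖filt ref des τ (q τ) (v τ)‖ ^ 2 :=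
      mul_nonneg des.k_pos.le (intervalIntegral.integral_nonneg hb fun _ _ => by positivity)
    have h7 : th 0 ^ 2 ≤ R ^ 2 := by
      have := hs.theta_init
      gcongr
    have h8 : 2 * θ * ((∫ τ in (0 : ℝ)..b, des.nu τ) + (th b - th 0) / des.sigma2)
        ≤ 2 * θ * N + (θ ^ 2 + R ^ 2) / des.sigma2 + 2 * z b / des.sigma1 := by
      have i1 : 2 * θ * (∫ τ in (0 : ℝ)..b, des.nu τ) ≤ 2 * θ * N := by gcongr
      have i2 : 2 * θ * ((th b - th 0) / des.sigma2)
          ≤ (θ ^ 2 + th b ^ 2) / des.sigma2 := by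
        rw [← mul_div_assoc]
        gcongr
        nlinarith [sq_nonneg (θ - th b), mul_nonneg hθ0 hs.theta_init]
      have i3 : th b ^ 2 / des.sigma2 ≤ R ^ 2 / des.sigma2 + 2 * z b / des.sigma1 := by
        have j1 : th b ^ 2 / des.sigma2 = 2 * (th b ^ 2 / (2 * des.sigma2)) := by
          field_simp
        have j2 : 2 * (th 0 ^ 2 / (2 * des.sigma2)) = th 0 ^ 2 / des.sigma2 := by
          field_simp
        have j3 : th 0 ^ 2 / des.sigma2 ≤ R ^ 2 / des.sigma2 := by gcongr
        have j4 : (z b - z 0) / des.sigma1 ≤ z b / des.sigma1 := by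
          gcongr
          linarith [hs.zeta_init]
        have j5 : 2 * z b / des.sigma1 = 2 * (z b / des.sigma1) := by ring
        linarith
      rw [mul_add, add_div]
      rw [add_div] at i2
      linarith
    have h9 : inner ℝ (filt ref des b (q b) (v b))
        (mulV (α (q b) b) (filt ref des b (q b) (v b)))
        ≤ V0 + (2 * θ * N + (θ ^ 2 + R ^ 2) / des.sigma2 + 2 * z b / des.sigma1)
          + 1 / des.sigma1 * (nussInt h lo hi (z b) + D0) := by
      have : 1 / des.sigma1 * (nussInt h lo hi (z b) - nussInt h lo hi (z 0))
          ≤ 1 / des.sigma1 * (nussInt h lo hi (z b) + D0) := by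
        gcongr
        linarith
      linarith
    refine (mul_le_mul_of_nonneg_left h9 hσ1.le).trans_eq ?_
    rw [hC]
    field_simp
    ring
  obtain ⟨Z, hZ, hneg⟩ := hN.exists_nussInt_neg hc.same_sign hL C 2 (max 0 R) (le_max_left _ _)
  obtain ⟨D1, hD1⟩ := (isCompact_Icc (a := (0 : ℝ)) (b := Z)).exists_bound_of_continuousOn
    hDc.continuousOn
  refine ⟨Z, (C + 2 * Z + D1) / des.sigma1, fun T q v z th hs hq hv hz hth b hb hbT => ?_⟩
  have hzb : z b ≤ Z := by
    by_contra! hcon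
    have hzc : ContinuousOn z (Icc 0 b) :=
      (HasACDeriv.of_isPrimitiveOn hs.zeta_eq hb hbT).continuousOn hb
    obtain ⟨t, ht, htZ⟩ := intermediate_value_Icc hb hzc
      ⟨hz.trans ((le_max_right 0 R).trans hZ.le), hcon.le⟩
    have h1 := key T q v z th hs hq hv hz hth t ht.1 (coe_lt_of_le hbT ht.2)
    have h2 := mul_nonneg hσ1.le (inner_mulV_nonneg (hc.posDef (q t) t ht.1).posSemidef
      (filt ref des t (q t) (v t)))
    rw [htZ] at h1
    linarith
  refine ⟨hzb, ?_⟩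
  rw [le_div_iff₀ hσ1]
  have h1 := key T q v z th hs hq hv hz hth b hb hbT
  have h2 : nussInt h lo hi (z b) ≤ D1 :=
    (le_abs_self _).trans (hD1 _ ⟨hs.zeta_nonneg hb hbT, hzb⟩)
  linarith

/-- Uniform bounds on all signals, together with uniform bounds on the energies of the tracking
error and of the filtered error. -/
theorem exists_uniform_bounds {L : EReal} (hN : IsBLNussbaum h L)
    (hc : Controllability rob flt α lo hi)
    (hL : ((max (lo / hi) (hi / lo) : ℝ) : EReal) < L) (hg : GrowthBounds rob flt bf α)
    (ref : Reference m) (des : Design) (R : ℝ) :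
    ∃ B I J : ℝ, ∀ (T : EReal) (q v : ℝ → Vec m) (z th : ℝ → ℝ),
      IsClosedLoop rob flt ref bf des h T q v z th →
      ‖q 0‖ ≤ R → ‖v 0‖ ≤ R → z 0 ≤ R → th 0 ≤ R →
      ∀ b : ℝ, 0 ≤ b → (b : EReal) < T →
        SignalsBoundedBy rob flt ref bf des h B b (q b) (v b) (z b) (th b) ∧
        ∫ τ in (0 : ℝ)..b, ‖filt ref des τ (q τ) (v τ)‖ ^ 2 ≤ I ∧
        ∫ τ in (0 : ℝ)..b, ‖err ref τ (q τ)‖ ^ 2 ≤ J := by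
  obtain ⟨Z, K, hZK⟩ := exists_zeta_le hN hc hL hg ref des R
  obtain ⟨E0, hE0⟩ := exists_initial_lyapunov_le hg ref des R
  have hσ1 := des.sigma1_pos
  have hσ2 := des.sigma2_pos
  have hk := des.k_pos
  have hlam := des.lam1_pos
  set X := R ^ 2 / (2 * des.sigma2) + Z / des.sigma1 with hX
  set Y := E0 ^ 2 + 1 / des.lam1 * (X / des.k) with hY
  obtain ⟨B, hB⟩ := exists_signalsBoundedBy (ref := ref) (des := des) hc hg
    hN.contDiffOn.continuousOn (√Y) K Z (√(2 * des.sigma2 * X))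
  refine ⟨B, X / des.k, Y / des.lam1, fun T q v z th hs hq hv hz hth b hb hbT => ?_⟩
  obtain ⟨h1, h2⟩ := hZK T q v z th hs hq hv hz hth b hb hbT
  have h3 := hs.energy_le hb hbT
  have h4 := hs.err_le hb hbT
  have h5 : th 0 ^ 2 / (2 * des.sigma2) + (z b - z 0) / des.sigma1 ≤ X := by
    have := hs.theta_init
    have := hs.zeta_init
    rw [hX]
    gcongr
    linarith
  have hs0 : 0 ≤ ∫ τ in (0 : ℝ)..b, ‖filt ref des τ (q τ) (v τ)‖ ^ 2 :=
    intervalIntegral.integral_nonneg hb fun _ _ => by positivity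
  have he0 : 0 ≤ ∫ τ in (0 : ℝ)..b, ‖err ref τ (q τ)‖ ^ 2 :=
    intervalIntegral.integral_nonneg hb fun _ _ => by positivity
  have h6 : 0 ≤ th b ^ 2 / (2 * des.sigma2) := by positivity
  have h7 : ∫ τ in (0 : ℝ)..b, ‖filt ref des τ (q τ) (v τ)‖ ^ 2 ≤ X / des.k := by
    rw [le_div_iff₀ hk]
    linarith
  have h8 : ‖err ref 0 (q 0)‖ ^ 2 ≤ E0 ^ 2 := by
    have := (hE0 _ _ hq hv).1
    gcongr
  have h9 : 1 / des.lam1 * ∫ τ in (0 : ℝ)..b, ‖filt ref des τ (q τ) (v τ)‖ ^ 2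
      ≤ 1 / des.lam1 * (X / des.k) := by gcongr
  have h10 := mul_nonneg hlam.le he0
  refine ⟨hB b _ _ _ _ hb ?_ h2 (hs.zeta_nonneg hb hbT) h1 (hs.theta_nonneg hb hbT) ?_, h7, ?_⟩
  · exact Real.le_sqrt_of_sq_le (by linarith)
  · refine Real.le_sqrt_of_sq_le ?_
    have h11 := mul_nonneg hk.le hs0
    have h12 : th b ^ 2 / (2 * des.sigma2) ≤ X := by linarith
    rw [div_le_iff₀ (by positivity)] at h12
    linarith
  · rw [le_div_iff₀ hlam]
    have := sq_nonneg ‖err ref b (q b)‖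
    linarith

end Uniform

/-! ### Convergence of the tracking error -/

section LipschitzBounds

variable {E : Type*} [NormedAddCommGroup E] [NormedSpace ℝ E]

theorem IsPrimitiveOn.norm_sub_le {f f' : ℝ → E} {C : ℝ} (hf : IsPrimitiveOn ⊤ f f')
    (hC : ∀ t, 0 ≤ t → ‖f' t‖ ≤ C) {x y : ℝ} (hx : 0 ≤ x) (hxy : x ≤ y) :
    ‖f y - f x‖ ≤ C * (y - x) := by
  obtain ⟨i1, e1⟩ := hf x hx (EReal.coe_lt_top x)
  obtain ⟨i2, e2⟩ := hf y (hx.trans hxy) (EReal.coe_lt_top y)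
  rw [e1, e2, add_sub_add_left_eq_sub, intervalIntegral.integral_interval_sub_left i2 i1]
  have := intervalIntegral.norm_integral_le_of_norm_le_const (a := x) (b := y) (f := f') (C := C)
    fun t ht => hC t (by rw [uIoc_of_le hxy] at ht; exact hx.trans ht.1.le)
  rwa [abs_of_nonneg (sub_nonneg.2 hxy)] at this

theorem norm_sub_le_of_hasDerivWithinAt {f f' : ℝ → E} {C : ℝ}
    (hf : ∀ t, 0 ≤ t → HasDerivWithinAt f (f' t) (Ici 0) t) (hC : ∀ t, 0 ≤ t → ‖f' t‖ ≤ C)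
    {x y : ℝ} (hx : 0 ≤ x) (hxy : x ≤ y) : ‖f y - f x‖ ≤ C * (y - x) := by
  have := (convex_Ici (0 : ℝ)).norm_image_sub_le_of_norm_hasDerivWithin_le hf hC
    (mem_Ici.2 hx) (mem_Ici.2 (hx.trans hxy))
  rwa [Real.norm_of_nonneg (sub_nonneg.2 hxy)] at this

end LipschitzBounds

end RobotFTC

theorem corollary1 {m : ℕ} (rob : Robot m) (flt : Fault m) (ref : Reference m)
    (bf : BoundFns m) (des : Design)
    (h : ℝ → ℝ) (L : EReal) (hNussbaum : IsBLNussbaum h L)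
    (α : Vec m → ℝ → Mat m) (lo hi : ℝ)
    (hctrl : Controllability rob flt α lo hi)
    (hL : ((max (lo / hi) (hi / lo) : ℝ) : EReal) < L)
    (hgrowth : GrowthBounds rob flt bf α) :
    (∀ R : ℝ, ∃ B : ℝ, ∀ (T : EReal) (q v : ℝ → Vec m) (z th : ℝ → ℝ),
      IsClosedLoop rob flt ref bf des h T q v z th →
      ‖q 0‖ ≤ R → ‖v 0‖ ≤ R → z 0 ≤ R → th 0 ≤ R →
      ∀ t : ℝ, 0 ≤ t → (t : EReal) < T →
        SignalsBoundedBy rob flt ref bf des h B t (q t) (v t) (z t) (th t)) ∧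
    (∀ (q v : ℝ → Vec m) (z th : ℝ → ℝ),
      IsClosedLoop rob flt ref bf des h ⊤ q v z th →
      Tendsto (fun t => err ref t (q t)) atTop (𝓝 0) ∧
      Tendsto (fun t => errDot ref t (v t)) atTop (𝓝 0)) := by
  refine ⟨fun R => ?_, fun q v z th hs => ?_⟩
  · obtain ⟨B, _, _, hB⟩ := exists_uniform_bounds hNussbaum hctrl hL hgrowth ref des R
    exact ⟨B, fun T q v z th hs hq hv hz hth t ht htT =>
      (hB T q v z th hs hq hv hz hth t ht htT).1⟩
  obtain ⟨B, I, J, hB⟩ := exists_uniform_bounds hNussbaum hctrl hL hgrowth ref des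
    (max (max ‖q 0‖ ‖v 0‖) (max (z 0) (th 0)))
  have hb := fun t ht => hB ⊤ q v z th hs (by simp) (by simp) (by simp) (by simp) t ht
    (EReal.coe_lt_top t)
  obtain ⟨bv, hbv⟩ := ref.vd_bounded
  obtain ⟨ba, hba⟩ := ref.ad_bounded
  have heL : ∀ x y, 0 ≤ x → x ≤ y →
      ‖err ref y (q y) - err ref x (q x)‖ ≤ (B + bv) * (y - x) := fun x y hx hxy => by
    have h1 := hs.pos_eq.norm_sub_le (fun t ht => (hb t ht).1.2.1) hx hxy
    have h2 := norm_sub_le_of_hasDerivWithinAt ref.qd_deriv hbv hx hxy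
    have e : err ref y (q y) - err ref x (q x) = (q y - q x) - (ref.qd y - ref.qd x) := by
      simp only [err]; abel
    rw [e]
    refine (norm_sub_le _ _).trans ?_
    linarith
  have hdL : ∀ x y, 0 ≤ x → x ≤ y →
      ‖errDot ref y (v y) - errDot ref x (v x)‖ ≤ (B + ba) * (y - x) := fun x y hx hxy => by
    have h1 := hs.vel_eq.norm_sub_le
      (fun t ht => by have := (hb t ht).1; unfold SignalsBoundedBy at this; tauto) hx hxy
    have h2 := norm_sub_le_of_hasDerivWithinAt ref.vd_deriv hba hx hxy
    have e : errDot ref y (v y) - errDot ref x (v x) = (v y - v x) - (ref.vd y - ref.vd x) := by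
      simp only [errDot]; abel
    rw [e]
    refine (norm_sub_le _ _).trans ?_
    linarith
  have he : Tendsto (fun t => err ref t (q t)) atTop (𝓝 0) :=
    tendsto_zero_of_integral_sq_le heL
      (fun t ht => hs.intervalIntegrable_err_sq ht (EReal.coe_lt_top t)) fun t ht => (hb t ht).2.2
  have hf : Tendsto (fun t => filt ref des t (q t) (v t)) atTop (𝓝 0) := by
    refine tendsto_zero_of_integral_sq_le (K := des.lam1 * (B + bv) + (B + ba))
      (fun x y hx hxy => ?_)
      (fun t ht => hs.intervalIntegrable_filt_sq ht (EReal.coe_lt_top t)) fun t ht => (hb t ht).2.1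
    have e : filt ref des y (q y) (v y) - filt ref des x (q x) (v x)
        = des.lam1 • (err ref y (q y) - err ref x (q x))
          + (errDot ref y (v y) - errDot ref x (v x)) := by
      simp only [filt, smul_sub]; abel
    rw [e]
    refine (norm_add_le _ _).trans ?_
    rw [norm_smul, Real.norm_of_nonneg des.lam1_pos.le]
    have := mul_le_mul_of_nonneg_left (heL x y hx hxy) des.lam1_pos.le
    linarith [hdL x y hx hxy]
  refine ⟨he, ?_⟩
  have := hf.sub (he.const_smul des.lam1)
  simpa [filt] using this
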